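/- Let $\Phi=\{x_i\}_{i\ge 1}$ be a homogeneous Poisson point process of density $\lambda>0$ in $\mathbb R^2$ (full-duplex base stations, BSs), and consider an additional typical BS located at the origin and labelled $0$. Each BS has $N_{\mathrm R}\ge 2$ receive and $N_{\mathrm T}\ge 1$ transmit antennas, transmits with power $\hat\rho>0$, and has its own uplink node, transmitting with power $\tilde\rho>0$ at fixed distance $\tilde R>0$, and its own downlink node. The uplink node of $x\in\Phi$ is at $\tilde m_x=x+\tilde R(\cos\varphi_x,\sin\varphi_x)$, the $\varphi_x$ being i.i.d. uniform on $[0,2\pi]$. Let $\mathbf H_{x0}\in\mathbb C^{N_{\mathrm R}\times N_{\mathrm T}}$, $\mathbf h_{\tilde m_x0}\in\mathbb C^{N_{\mathrm R}}$ and $\mathbf h_{x\hat m_x}\in\mathbb C^{N_{\mathrm T}}$ ($x\in\Phi\cup\{0\}$) be the channels from BS $x$ to BS $0$, from the uplink node of $x$ to BS $0$, and from BS $x$ to its own downlink node. All their entries are independent; they are $\mathcal{CN}(0,1)$ except that the $(i,j)$-th entry of the self-interference channel $\mathbf H_{00}$ is $\mathcal{CN}(\mu_{ij},\Omega/(K+1))$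 with $|\mu_{ij}|=\sqrt{K\Omega/(K+1)}$, for given $K\ge 0$ and $\Omega>0$. Positions, directions and channels are mutually independent. Every BS uses the beamforming vector $\mathbf w_x=\mathbf h_{x\hat m_x}/\|\mathbf h_{x\hat m_x}\|$, and BS $0$ uses partial zero forcing to null its own self-interference, that is, its receive combining vector is $\mathbf v_0=\mathbf u/\|\mathbf u\|$, where $\mathbf u$ is the orthogonal projection of $\mathbf h_{\tilde m_00}$ onto the orthogonal complement of $\mathbf H_{00}\mathbf w_0$. Put $S_{x0}=|\mathbf v_0^{\mathrm H}\mathbf H_{x0}\mathbf w_x|^2$ and $S_{\tilde m_x0}=|\mathbf v_0^{\mathrm H}\mathbf h_{\tilde m_x0}|^2$. With path-loss exponent $\alpha>2$, let $$I_0=\sum_{x\in\Phi}\big(\hat\rho\,\|x\|^{-\alpha}S_{x0}+\tilde\rho\,\|\tilde m_x\|^{-\alpha}S_{\tilde m_x0}\big),\qquad \mathrm P^{(1)}_{\mathrm{suc}}(\theta)=\Pr\Big[\frac{\tilde\rho\tilde R^{-\alpha}S_{\tilde m_00}}{I_0}>\theta\Big]$$ be the interference power and, for a threshold $\theta>0$,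 the success probability of the first hop (in the interference-limited regime, noise being neglected). For $s>0$ and $r>0$ let $$\Psi(s,r)=\frac1{2\pi}\int_0^{2\pi}\frac{d\varphi}{1+s\tilde\rho\,(r^2+\tilde R^2+2r\tilde R\cos\varphi)^{-\alpha/2}},\qquad \Upsilon(s)=2\pi\int_0^\infty\Big(1-\frac{\Psi(s,r)}{1+s\hat\rho\,r^{-\alpha}}\Big)r\,dr .$$ Then the series $I_0$ converges almost surely; adding to it the self-interference term $\hat\rho S_{00}$ does not change it; the integral defining $\Upsilon(s)$ converges for every $s>0$; $s\mapsto e^{-\lambda\Upsilon(s)}$ is infinitely differentiable on $(0,\infty)$; and $$\mathrm P^{(1)}_{\mathrm{suc}}(\theta)=\sum_{n=0}^{N_{\mathrm R}-2}\left[\frac{(-s)^n}{n!}\,\frac{d^n}{ds^n}\,e^{-\lambda\Upsilon(s)}\right]_{s=\theta\tilde\rho^{-1}\tilde R^{\alpha}} .$$ -/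

import Mathlib

open MeasureTheory ProbabilityTheory Set
open scoped ENNReal NNReal Matrix

noncomputable section

namespace FDNet

/-- The Euclidean plane. -/
abbrev Plane : Type := EuclideanSpace ℝ (Fin 2)

/-- Number of points (with multiplicity) of the sequence `x` that lie in `A`. -/
def pointCount {Ω E : Type*} (x : ℕ → Ω → E) (A : Set E) (ω : Ω) : ℕ∞ :=
  {i : ℕ | x i ω ∈ A}.encard

/-- The random points `x 0, x 1, …` form (an enumeration of) a Poisson point process with
intensity measure `Λ`: the number of points in a set of finite intensity is Poisson distributed
and the numbers of points in pairwise disjoint sets are independent. -/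
structure IsPoissonPointProcess {Ω E : Type*} [MeasurableSpace Ω] [MeasurableSpace E]
    (x : ℕ → Ω → E) (Λ : Measure E) (P : Measure Ω) : Prop where
  measurable_point : ∀ i, Measurable (x i)
  law_count : ∀ A : Set E, MeasurableSet A → Λ A ≠ ∞ →
    HasLaw (pointCount x A) ((poissonMeasure (Λ A).toNNReal).map (fun n : ℕ => (n : ℕ∞))) P
  indep_count : ∀ (n : ℕ) (A : Fin n → Set E), (∀ j, MeasurableSet (A j)) →
    Pairwise (fun j k => Disjoint (A j) (A k)) →
    iIndepFun (fun j => pointCount x (A j)) P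

/-- The circularly symmetric complex normal law `CN(m, v)` with mean `m` and variance
`E|Z - m|² = v`. -/
def complexNormal (m : ℂ) (v : ℝ≥0) : Measure ℂ :=
  ((gaussianReal m.re (v / 2)).prod (gaussianReal m.im (v / 2))).map
    (fun p : ℝ × ℝ => (⟨p.1, p.2⟩ : ℂ))

/-- The scalar channel coefficients that matter at the typical base station, which sits at the
origin. The label `none` stands for the typical base station and `some i` for the `i`-th other
base station.
* `bs k i j`: entry `(i, j)` of the channel matrix from base station `k` to the typical base
  station (so `bs none` is the self-interference channel);
* `ul k i`: entry `i` of the channel from the uplink node of base station `k` to the typical base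
  station;
* `dl k j`: entry `j` of the channel from base station `k` to its own downlink node. -/
inductive ChannelEntry (NR NT : ℕ) : Type
  | bs (k : Option ℕ) (i : Fin NR) (j : Fin NT)
  | ul (k : Option ℕ) (i : Fin NR)
  | dl (k : Option ℕ) (j : Fin NT)

/-- Mean of a channel coefficient: `m i j` for the self-interference channel, and zero for all
others. -/
def ChannelEntry.mean {NR NT : ℕ} (m : Fin NR → Fin NT → ℂ) : ChannelEntry NR NT → ℂ
  | .bs none i j => m i j
  | .bs (some _) _ _ => 0
  | .ul _ _ => 0
  | .dl _ _ => 0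

/-- Variance of a channel coefficient: `v` for the self-interference channel, and one for all
others. -/
def ChannelEntry.var {NR NT : ℕ} (v : ℝ≥0) : ChannelEntry NR NT → ℝ≥0
  | .bs none _ _ => v
  | .bs (some _) _ _ => 1
  | .ul _ _ => 1
  | .dl _ _ => 1

/-- The random data of the network: positions of the base stations other than the typical one,
directions of their uplink nodes, and channel coefficients. -/
structure Network (NR NT : ℕ) (Ω : Type*) where
  site : ℕ → Ω → Plane
  angle : ℕ → Ω → ℝ
  chan : ChannelEntry NR NT → Ω → ℂ

/-- The probabilistic assumptions on the network: the base stations form a homogeneous Poisson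
point process of density `lam`, independently marked by uniform directions; all channel
coefficients are independent, `CN(0, 1)` except for the self-interference channel, whose entries
are `CN(m i j, Att / (K + 1))` with `|m i j| = √(K Att / (K + 1))` (Rician fading with factor `K`
and attenuation `Att`); positions, directions and fading are independent of each other. -/
structure Network.IsModel {NR NT : ℕ} {Ω : Type*} [MeasurableSpace Ω]
    (N : Network NR NT Ω) (P : Measure Ω) (lam K Att : ℝ) (m : Fin NR → Fin NT → ℂ) : Prop where
  mean_abs : ∀ i j, ‖m i j‖ = Real.sqrt (K * Att / (K + 1))
  sites : IsPoissonPointProcess N.site (ENNReal.ofReal lam • (volume : Measure Plane)) P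
  measurable_angle : ∀ i, Measurable (N.angle i)
  law_angle : ∀ i,
    HasLaw (N.angle i) (cond (volume : Measure ℝ) (Icc 0 (2 * Real.pi))) P
  indep_angle : iIndepFun N.angle P
  measurable_chan : ∀ c, Measurable (N.chan c)
  law_chan : ∀ c,
    HasLaw (N.chan c) (complexNormal (c.mean m) (c.var (Att / (K + 1)).toNNReal)) P
  indep_chan : iIndepFun N.chan P
  indep_angle_chan : IndepFun (fun ω i => N.angle i ω) (fun ω c => N.chan c ω) P
  indep_site_marks : IndepFun (fun ω i => N.site i ω)
    (fun ω => ((fun i => N.angle i ω), (fun c => N.chan c ω))) P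

/-- Partial zero forcing: project the desired channel `h` onto the orthogonal complement of the
span of the columns `q` to be nulled (this is `(I - Q Q♯) h`, with `Q♯` the Moore–Penrose
pseudoinverse) and normalize. -/
def partialZeroForcing {n M : ℕ} (q : Fin M → EuclideanSpace ℂ (Fin n))
    (h : EuclideanSpace ℂ (Fin n)) : EuclideanSpace ℂ (Fin n) :=
  let u := ((Submodule.span ℂ (range q))ᗮ).starProjection h
  ((‖u‖⁻¹ : ℝ) : ℂ) • u

namespace Network

variable {NR NT : ℕ} {Ω : Type*} (N : Network NR NT Ω)

/-- Channel matrix from base station `k` to the typical base station. -/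
def bsChannel (k : Option ℕ) (ω : Ω) : Matrix (Fin NR) (Fin NT) ℂ :=
  Matrix.of fun i j => N.chan (.bs k i j) ω

/-- Channel from the uplink node of base station `k` to the typical base station. -/
def ulChannel (k : Option ℕ) (ω : Ω) : EuclideanSpace ℂ (Fin NR) :=
  WithLp.toLp 2 fun i => N.chan (.ul k i) ω

/-- Channel from base station `k` to its own downlink node. -/
def dlChannel (k : Option ℕ) (ω : Ω) : EuclideanSpace ℂ (Fin NT) :=
  WithLp.toLp 2 fun j => N.chan (.dl k j) ω

/-- Maximum ratio transmission beamforming vector of base station `k`. -/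
def beam (k : Option ℕ) (ω : Ω) : EuclideanSpace ℂ (Fin NT) :=
  ((‖N.dlChannel k ω‖⁻¹ : ℝ) : ℂ) • N.dlChannel k ω

/-- Effective channel (channel matrix times beamforming vector) from base station `k` to the
typical base station. -/
def effChannel (k : Option ℕ) (ω : Ω) : EuclideanSpace ℂ (Fin NR) :=
  WithLp.toLp 2 (N.bsChannel k ω *ᵥ WithLp.ofLp (N.beam k ω))

/-- Receive combining vector of the typical base station: partial zero forcing of its own
effective self-interference channel. -/
def combiner (ω : Ω) : EuclideanSpace ℂ (Fin NR) :=
  partialZeroForcing (fun _ : Fin 1 => N.effChannel none ω) (N.ulChannel none ω)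

/-- Power gain from base station `k` after combining. -/
def bsPower (k : Option ℕ) (ω : Ω) : ℝ :=
  ‖inner ℂ (N.combiner ω) (N.effChannel k ω)‖ ^ 2

/-- Power gain from the uplink node of base station `k` after combining. -/
def ulPower (k : Option ℕ) (ω : Ω) : ℝ :=
  ‖inner ℂ (N.combiner ω) (N.ulChannel k ω)‖ ^ 2

/-- Position of the uplink node of the `i`-th base station, at distance `R` from it. -/
def ulSite (R : ℝ) (i : ℕ) (ω : Ω) : Plane :=
  N.site i ω + R • !₂[Real.cos (N.angle i ω), Real.sin (N.angle i ω)]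

/-- Interference received by the typical base station from the `i`-th base station (transmit
power `ρB`) together with its uplink node (transmit power `ρU`). -/
def cellInterference (α ρB ρU R : ℝ) (i : ℕ) (ω : Ω) : ℝ :=
  ρB * ‖N.site i ω‖ ^ (-α) * N.bsPower (some i) ω
    + ρU * ‖N.ulSite R i ω‖ ^ (-α) * N.ulPower (some i) ω

/-- Overall interference without the self-interference term. -/
def zfInterference (α ρB ρU R : ℝ) (ω : Ω) : ℝ :=
  ∑' i, N.cellInterference α ρB ρU R i ω

/-- Overall interference including the self-interference term. -/
def totalInterference (α ρB ρU R : ℝ) (ω : Ω) : ℝ :=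
  N.zfInterference α ρB ρU R ω + ρB * N.bsPower none ω

/-- Signal-to-interference ratio of the first hop. -/
def firstHopSIR (α ρB ρU R : ℝ) (ω : Ω) : ℝ :=
  ρU * R ^ (-α) * N.ulPower none ω / N.zfInterference α ρB ρU R ω

end Network

/-- The angular average `Ψ(s, r)`. -/
def Psi (α ρU R s r : ℝ) : ℝ :=
  1 / (2 * Real.pi) * ∫ φ in (0 : ℝ)..(2 * Real.pi),
    1 / (1 + s * ρU * (r ^ 2 + R ^ 2 + 2 * r * R * Real.cos φ) ^ (-(α / 2)))

/-- The radial integrand of `Υ(s)`. -/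
def upsilonIntegrand (α ρB ρU R s r : ℝ) : ℝ :=
  (1 - 1 / (1 + s * ρB * r ^ (-α)) * Psi α ρU R s r) * r

/-- The function `Υ(s)`. -/
def Upsilon (α ρB ρU R s : ℝ) : ℝ :=
  2 * Real.pi * ∫ r in Ioi (0 : ℝ), upsilonIntegrand α ρB ρU R s r

end FDNet

end

/-! The combiner is orthogonal to the effective self-interference channel, so the self-interference
term vanishes identically and the desired power is the squared norm of the projection of a standard
complex Gaussian vector onto the orthogonal complement of an almost surely nonzero vector in
dimension `NR`. By unitary invariance this is distributed as a sum of `NR - 1` independent unit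
exponentials, with tail `erlangTail (NR - 1)` (`IsModel.measure_ulPower_none_gt`).

The combiner is a function of the typical station's own coefficients and almost surely has norm one.
Given those coefficients, the combined gains of all other stations and uplink nodes are i.i.d.
`CN(0, 1)`. This conditional law does not depend on the condition, so positions, directions and
gains are jointly independent of the desired power (`IsModel.indepFun_and_hasLaw_gain`).

Averaging over gains and directions turns each cell into a factor `cellTransform`, which depends on
the position only through its norm because the direction is uniform. The Laplace functional of the
Poisson process and polar coordinates then give `E e^{-sI} = e^{-λΥ(s)}`
(`IsModel.lintegral_expNeg_tsum_cell`). The computation takes place in `[0, ∞]`, so no convergence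
is presupposed; letting `s → 0` yields `I < ∞` almost surely. The integral `Υ` converges since `1 -
cellTransform` is `O(r^{-α})` at infinity and `α > 2`.

Conditioning on the interference, the success probability is the expectation of `erlangTail (NR -
1)` at `sI`, with `s = θ ρU⁻¹ R^α`. Each term `(sI)^n e^{-sI} / n!` has expectation `(-s)^n / n!`
times the `n`-th derivative of the Laplace transform. Since `I ≥ 0`, the moment generating function
is analytic on the negative half-line, which justifies the differentiation and gives the smoothness.
-/

noncomputable section

namespace FDNet

/-! ### The Laplace functional of a Poisson point process -/

/-- The function `x ↦ e⁻ˣ` on `[0, ∞]`. -/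
def expNeg (x : ℝ≥0∞) : ℝ≥0∞ := EReal.exp (-(x : EReal))

lemma expNeg_zero : expNeg 0 = 1 := by simp [expNeg]

lemma expNeg_top : expNeg ∞ = 0 := by simp [expNeg]

lemma expNeg_add (x y : ℝ≥0∞) : expNeg (x + y) = expNeg x * expNeg y := by
  by_cases hx : x = ∞
  · simp [hx, expNeg_top]
  by_cases hy : y = ∞
  · simp [hy, expNeg_top]
  rw [expNeg, expNeg, expNeg, ← EReal.exp_add, EReal.coe_ennreal_add, EReal.neg_add, sub_eq_add_neg]
  · left; simp
  · right; simp

lemma expNeg_sum {ι : Type*} (s : Finset ι) (f : ι → ℝ≥0∞) :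
    expNeg (∑ i ∈ s, f i) = ∏ i ∈ s, expNeg (f i) := by
  classical
  induction s using Finset.induction_on with
  | empty => simp [expNeg_zero]
  | insert a s ha ih => rw [Finset.sum_insert ha, Finset.prod_insert ha, expNeg_add, ih]

lemma expNeg_natCast_mul (n : ℕ) (x : ℝ≥0∞) : expNeg (n * x) = expNeg x ^ n := by
  simpa using expNeg_sum (Finset.range n) (fun _ => x)

lemma expNeg_ofReal {t : ℝ} (ht : 0 ≤ t) :
    expNeg (ENNReal.ofReal t) = ENNReal.ofReal (Real.exp (-t)) := by
  rw [expNeg, EReal.coe_ennreal_ofReal, max_eq_left ht, ← EReal.coe_neg, EReal.exp_coe]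

lemma expNeg_antitone : Antitone expNeg := fun _ _ h =>
  EReal.exp_monotone (EReal.neg_le_neg_iff.2 (EReal.coe_ennreal_le_coe_ennreal_iff.2 h))

lemma expNeg_le_one (x : ℝ≥0∞) : expNeg x ≤ 1 := by
  simpa [expNeg_zero] using expNeg_antitone (zero_le (a := x))

lemma expNeg_ne_top (x : ℝ≥0∞) : expNeg x ≠ ∞ := ((expNeg_le_one x).trans_lt ENNReal.one_lt_top).ne

lemma continuous_expNeg : Continuous expNeg :=
  ENNReal.continuous_exp.comp (continuous_neg.comp continuous_coe_ennreal_ereal)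

lemma measurable_expNeg : Measurable expNeg := continuous_expNeg.measurable

/-- The exponential series at `rz`, multiplied by `e^{-r}`: the Poisson generating function. -/
lemma lintegral_poissonMeasure_pow (r : ℝ≥0) {z : ℝ} (hz : 0 ≤ z) :
    ∫⁻ n : ℕ, ENNReal.ofReal z ^ n ∂(poissonMeasure r) =
      ENNReal.ofReal (Real.exp (-(r * (1 - z)))) := by
  rw [poissonMeasure, lintegral_sum_measure]
  simp only [lintegral_smul_measure, lintegral_dirac, smul_eq_mul]
  have h : HasSum (fun n : ℕ => Real.exp (-r) * r ^ n / n.factorial * z ^ n)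
      (Real.exp (-(r * (1 - z)))) := by
    have := (NormedSpace.expSeries_div_hasSum_exp (r * z : ℝ)).mul_left (Real.exp (-r))
    rw [← Real.exp_eq_exp_ℝ, ← Real.exp_add] at this
    have h1 : -(r * (1 - z)) = -(r : ℝ) + r * z := by ring
    rw [h1]
    convert! this using 2 with n
    rw [mul_pow]
    ring
  rw [← h.tsum_eq, ENNReal.ofReal_tsum_of_nonneg (fun n => by positivity) h.summable]
  refine tsum_congr fun n => ?_
  rw [ENNReal.ofReal_mul (by positivity), ENNReal.ofReal_pow hz]

/-- Links counts to sums over the enumeration; it also supplies the measurability of the counts. -/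
lemma toENNReal_pointCount {Ω E : Type*} (x : ℕ → Ω → E) (A : Set E) (ω : Ω) :
    (pointCount x A ω : ℝ≥0∞) = ∑' i, A.indicator (fun _ => 1) (x i ω) := by
  rw [pointCount, ← ENNReal.tsum_set_one]
  exact tsum_subtype {i | x i ω ∈ A} (fun _ => (1 : ℝ≥0∞))

section Poisson

variable {Ω E : Type*} [MeasurableSpace Ω] [MeasurableSpace E] {x : ℕ → Ω → E} {Λ : Measure E}
  {P : Measure Ω}

/-- The Poisson generating function at `z = e^{-y}`. The value `y = ∞` is included, with `z = 0`. -/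
lemma IsPoissonPointProcess.lintegral_expNeg_pointCount (hx : IsPoissonPointProcess x Λ P)
    {A : Set E} (hA : MeasurableSet A) (hfin : Λ A ≠ ∞) (y : ℝ≥0∞) :
    ∫⁻ ω, expNeg (pointCount x A ω * y) ∂P = expNeg ((1 - expNeg y) * Λ A) := by
  rw [(hx.law_count A hA hfin).lintegral_comp (f := fun n : ℕ∞ => expNeg (n * y))
    (Measurable.of_discrete).aemeasurable, lintegral_map Measurable.of_discrete
    Measurable.of_discrete]
  simp only [ENat.toENNReal_coe, expNeg_natCast_mul]
  set z := (expNeg y).toReal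
  have hz : expNeg y = ENNReal.ofReal z := (ENNReal.ofReal_toReal (expNeg_ne_top y)).symm
  have hz0 : 0 ≤ z := ENNReal.toReal_nonneg
  have hz1 : z ≤ 1 := ENNReal.toReal_le_of_le_ofReal zero_le_one (by simpa using expNeg_le_one y)
  rw [hz, lintegral_poissonMeasure_pow _ hz0, ← ENNReal.ofReal_one, ← ENNReal.ofReal_sub _ hz0]
  have : Λ A = ENNReal.ofReal (Λ A).toNNReal := by simp [ENNReal.coe_toNNReal hfin]
  conv_rhs => rw [this]
  rw [← ENNReal.ofReal_mul (by linarith), expNeg_ofReal (by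
    apply mul_nonneg (by linarith) (NNReal.coe_nonneg _)), mul_comm]

/-- On the level sets of the nonzero values the sum is a finite combination of counts. These sets
are disjoint, so the counts are independent and the expectation factorizes. Finite intensity of the
support makes every level set used have a Poisson count. -/
lemma IsPoissonPointProcess.lintegral_expNeg_tsum_simpleFunc (hx : IsPoissonPointProcess x Λ P)
    (h : SimpleFunc E ℝ≥0∞) (hfin : Λ (Function.support h) ≠ ∞) :
    ∫⁻ ω, expNeg (∑' i, h (x i ω)) ∂P = expNeg (∫⁻ y, (1 - expNeg (h y)) ∂Λ) := by
  classical
  let S := h.range.filter (· ≠ 0)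
  let c : Fin S.card → ℝ≥0∞ := fun j => (S.equivFin.symm j : ℝ≥0∞)
  let A : Fin S.card → Set E := fun j => h ⁻¹' {c j}
  have hc : ∀ j, c j ≠ 0 := fun j => (Finset.mem_filter.1 (S.equivFin.symm j).2).2
  have hcinj : Function.Injective c := Subtype.val_injective.comp S.equivFin.symm.injective
  have hA : ∀ j, MeasurableSet (A j) := fun j => h.measurableSet_fiber _
  have hAfin : ∀ j, Λ (A j) ≠ ∞ := fun j =>
    ne_top_of_le_ne_top hfin (measure_mono fun y (hy : h y = c j) => by
      simpa [hy] using hc j)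
  -- Needed for `F = id` on the probabilistic side and for `F u = 1 - e^{-u}` in the exponent.
  have hsum : ∀ (F : ℝ≥0∞ → ℝ≥0∞), F 0 = 0 → ∀ y,
      F (h y) = ∑ j, F (c j) * (A j).indicator (fun _ => 1) y := by
    intro F hF y
    by_cases hy : h y = 0
    · rw [hy, hF, eq_comm]
      refine Finset.sum_eq_zero fun j _ => ?_
      rw [indicator_of_notMem, mul_zero]
      intro hj
      exact hc j ((show h y = c j from hj).symm.trans hy)
    · have hyS : h y ∈ S := Finset.mem_filter.2 ⟨h.mem_range_self y, hy⟩
      have hj0 : c (S.equivFin ⟨h y, hyS⟩) = h y := by simp [c]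
      rw [Finset.sum_eq_single (S.equivFin ⟨h y, hyS⟩)]
      · rw [indicator_of_mem (show y ∈ A _ from hj0.symm), mul_one, hj0]
      · intro j _ hj
        rw [indicator_of_notMem, mul_zero]
        intro hjA
        exact hj (hcinj ((show h y = c j from hjA).symm.trans hj0.symm))
      · simp
  have hN : ∀ ω, ∑' i, h (x i ω) = ∑ j, (pointCount x (A j) ω : ℝ≥0∞) * c j := by
    intro ω
    have h1 : ∀ i, h (x i ω) = ∑ j, c j * (A j).indicator (fun _ => 1) (x i ω) :=
      fun i => hsum id rfl (x i ω)
    simp_rw [h1]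
    rw [Summable.tsum_finsetSum fun _ _ => ENNReal.summable]
    refine Finset.sum_congr rfl fun j _ => ?_
    rw [ENNReal.tsum_mul_left, toENNReal_pointCount, mul_comm]
  have hind := (hx.indep_count _ A hA (fun j k hjk => by
    refine Set.disjoint_left.2 fun y hy hy' => hjk (hcinj ?_)
    exact (show h y = c j from hy).symm.trans hy')).comp
    (fun j (n : ℕ∞) => expNeg (n * c j)) (fun j => Measurable.of_discrete)
  have hmeas : ∀ j, Measurable fun ω => expNeg (pointCount x (A j) ω * c j) := by
    intro j
    refine measurable_expNeg.comp (Measurable.mul_const ?_ _)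
    simp_rw [toENNReal_pointCount]
    exact Measurable.tsum fun i =>
      (measurable_const.indicator (hA j)).comp (hx.measurable_point i)
  simp_rw [hN, expNeg_sum]
  rw [lintegral_prod_eq_prod_lintegral_of_indepFun _
    (fun j ω => expNeg (pointCount x (A j) ω * c j)) hind hmeas]
  simp_rw [fun j => hx.lintegral_expNeg_pointCount (hA j) (hAfin j) (c j)]
  rw [← expNeg_sum]
  congr 1
  simp_rw [fun y => hsum (fun u => 1 - expNeg u) (by simp [expNeg_zero]) y]
  rw [lintegral_finsetSum _ fun j _ => (measurable_const.indicator (hA j)).const_mul _]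
  refine Finset.sum_congr rfl fun j _ => ?_
  rw [lintegral_const_mul _ (measurable_const.indicator (hA j)), lintegral_indicator_const (hA j),
    one_mul]

/-- The Laplace functional of a Poisson point process. -/
theorem IsPoissonPointProcess.lintegral_expNeg_tsum [SigmaFinite Λ] [IsFiniteMeasure P]
    (hx : IsPoissonPointProcess x Λ P) {h : E → ℝ≥0∞} (hh : Measurable h) :
    ∫⁻ ω, expNeg (∑' i, h (x i ω)) ∂P = expNeg (∫⁻ y, (1 - expNeg (h y)) ∂Λ) := by
  -- Cutting off to the spanning sets gives supports of finite intensity and keeps the approximation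
  -- increasing to `h`.
  let g : ℕ → SimpleFunc E ℝ≥0∞ := fun n =>
    (SimpleFunc.eapprox h n).restrict (spanningSets Λ n)
  have hg : ∀ n y, g n y = (spanningSets Λ n).indicator (SimpleFunc.eapprox h n) y := fun n y =>
    SimpleFunc.restrict_apply _ (measurableSet_spanningSets Λ n) y
  have hmono : ∀ y, Monotone fun n => g n y := by
    intro y n m hnm
    simp only [hg]
    refine (indicator_le_indicator_of_subset (monotone_spanningSets Λ hnm) (by simp) y).trans ?_
    exact indicator_le_indicator (SimpleFunc.monotone_eapprox h hnm y)
  have hlim : ∀ y, Filter.Tendsto (fun n => g n y) Filter.atTop (nhds (h y)) := by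
    intro y
    have h1 : Filter.Tendsto (fun n => SimpleFunc.eapprox h n y) Filter.atTop (nhds (h y)) := by
      rw [← SimpleFunc.iSup_eapprox_apply hh y]
      exact tendsto_atTop_iSup fun n m hnm => SimpleFunc.monotone_eapprox h hnm y
    refine h1.congr' ?_
    filter_upwards [Filter.eventually_ge_atTop (spanningSetsIndex Λ y)] with n hn
    rw [hg, indicator_of_mem]
    exact monotone_spanningSets Λ hn (mem_spanningSetsIndex Λ y)
  have hfin : ∀ n, Λ (Function.support (g n)) ≠ ∞ := by
    intro n
    refine ne_top_of_le_ne_top (measure_spanningSets_lt_top Λ n).ne (measure_mono fun y hy => ?_)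
    by_contra hy'
    exact hy (by rw [hg, indicator_of_notMem hy'])
  have hL : Filter.Tendsto (fun n => ∫⁻ ω, expNeg (∑' i, g n (x i ω)) ∂P) Filter.atTop
      (nhds (∫⁻ ω, expNeg (∑' i, h (x i ω)) ∂P)) := by
    refine tendsto_lintegral_of_dominated_convergence (fun _ => 1) (fun n => ?_)
      (fun n => .of_forall fun ω => expNeg_le_one _) (by simp) (.of_forall fun ω => ?_)
    · exact measurable_expNeg.comp (Measurable.tsum fun i =>
        (g n).measurable.comp (hx.measurable_point i))
    · refine (continuous_expNeg.tendsto _).comp ?_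
      -- Sums over the points become integrals for counting measure, so monotone convergence
      -- applies.
      simp_rw [← lintegral_count]
      exact lintegral_tendsto_of_tendsto_of_monotone (fun n => by fun_prop)
        (.of_forall fun i => hmono _) (.of_forall fun i => hlim _)
  have hR : Filter.Tendsto (fun n => expNeg (∫⁻ y, (1 - expNeg (g n y)) ∂Λ)) Filter.atTop
      (nhds (expNeg (∫⁻ y, (1 - expNeg (h y)) ∂Λ))) := by
    refine (continuous_expNeg.tendsto _).comp ?_
    refine lintegral_tendsto_of_tendsto_of_monotone
      (fun n => (measurable_const.sub (measurable_expNeg.comp (g n).measurable)).aemeasurable)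
      (.of_forall fun y n m hnm => tsub_le_tsub_left (expNeg_antitone (hmono y hnm)) _)
      (.of_forall fun y => ?_)
    exact ENNReal.Tendsto.sub tendsto_const_nhds ((continuous_expNeg.tendsto _).comp (hlim y))
      (.inl ENNReal.one_ne_top)
  simp_rw [fun n => hx.lintegral_expNeg_tsum_simpleFunc (g n) (hfin n)] at hL
  exact tendsto_nhds_unique hL hR

end Poisson

/-! ### Independence of groups of variables and conditional laws -/

section Independence

variable {Ω : Type*} [MeasurableSpace Ω] {P : Measure Ω}

/-- If a family of random variables is independent, then so are the groups of variables given by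
the fibers of a map. -/
lemma iIndepFun_fibers [IsProbabilityMeasure P] {ι κ E : Type*} [MeasurableSpace E]
    {X : ι → Ω → E} (hX : ∀ i, Measurable (X i)) (h : iIndepFun X P) (g : ι → κ) :
    iIndepFun (fun k ω (i : {i // g i = k}) => X i ω) P := by
  have hprob : ∀ i, IsProbabilityMeasure (P.map (X i)) := fun i =>
    Measure.isProbabilityMeasure_map (hX i).aemeasurable
  have h1 : iIndepFun (fun (p : Σ k, {i // g i = k}) => X p.2) P :=
    h.precomp (g := fun p : Σ k, {i // g i = k} => (p.2 : ι))
      (Equiv.sigmaFiberEquiv g).injective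
  rw [iIndepFun_iff_map_fun_eq_infinitePi_map
    (X := fun p : Σ k, {i // g i = k} => X p.2) (fun p => hX p.2)] at h1
  rw [iIndepFun_iff_map_fun_eq_infinitePi_map (X := fun k ω (i : {i // g i = k}) => X i ω)
    (fun k => measurable_pi_lambda _ fun i => hX i)]
  -- Independence over all pairs (group, member) says that the joint law is one infinite product.
  -- Currying turns it into a product over groups of products over members.
  have h2 := congrArg (Measure.map
    (MeasurableEquiv.piCurry fun (k : κ) (_ : {i // g i = k}) => E)) h1
  rw [Measure.map_map (by fun_prop) (measurable_pi_lambda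
      (fun ω (p : Σ k, {i // g i = k}) => X p.2 ω) fun p => hX p.2),
    Measure.infinitePi_map_piCurry
      (fun (k : κ) (i : {i // g i = k}) => P.map (X i))] at h2
  refine Eq.trans h2 ?_
  congr 1
  ext1 k
  refine ((iIndepFun_iff_map_fun_eq_infinitePi_map (fun i : {i // g i = k} => hX i)).1 ?_).symm
  exact h.precomp Subtype.val_injective

/-- If `X` and `Y` are independent and the law `ν` of `F a Y` does not depend on `a`, then `F X Y`
has law `ν` and is independent of `X`. -/
lemma hasLaw_prod_of_forall_map_eq [IsProbabilityMeasure P] {A B C : Type*} [MeasurableSpace A]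
    [MeasurableSpace B] [MeasurableSpace C] {X : Ω → A} {Y : Ω → B} (hX : Measurable X)
    (hY : Measurable Y) (hXY : IndepFun X Y P) {F : A → B → C}
    (hF : Measurable (Function.uncurry F)) {ν : Measure C} [IsProbabilityMeasure ν]
    (h : ∀ᵐ ω ∂P, P.map (fun ω' => F (X ω) (Y ω')) = ν) :
    HasLaw (fun ω => (X ω, F (X ω) (Y ω))) ((P.map X).prod ν) P := by
  have hm : Measurable fun ω => (X ω, F (X ω) (Y ω)) := hX.prodMk (hF.comp (hX.prodMk hY))
  have : IsProbabilityMeasure (P.map X) := Measure.isProbabilityMeasure_map hX.aemeasurable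
  have : IsProbabilityMeasure (P.map Y) := Measure.isProbabilityMeasure_map hY.aemeasurable
  refine ⟨hm.aemeasurable, ?_⟩
  refine (Measure.prod_eq fun s t hs ht => ?_).symm
  have hT : MeasurableSet {p : A × B | p.1 ∈ s ∧ F p.1 p.2 ∈ t} :=
    (measurable_fst hs).inter (hF ht)
  rw [Measure.map_apply hm (hs.prod ht)]
  have e1 : (fun ω => (X ω, F (X ω) (Y ω))) ⁻¹' s ×ˢ t =
      (fun ω => (X ω, Y ω)) ⁻¹' {p : A × B | p.1 ∈ s ∧ F p.1 p.2 ∈ t} := rfl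
  rw [e1, ← Measure.map_apply (hX.prodMk hY) hT,
    (indepFun_iff_map_prod_eq_prod_map_map hX.aemeasurable hY.aemeasurable).1 hXY,
    Measure.prod_apply hT, lintegral_map (measurable_measure_prodMk_left hT) hX]
  have e2 : ∀ᵐ ω ∂P, (P.map Y) (Prod.mk (X ω) ⁻¹' {p : A × B | p.1 ∈ s ∧ F p.1 p.2 ∈ t}) =
      (X ⁻¹' s).indicator (fun _ => ν t) ω := by
    filter_upwards [h] with ω hω
    by_cases hs' : X ω ∈ s
    · rw [indicator_of_mem (show ω ∈ X ⁻¹' s from hs'), ← hω,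
        Measure.map_apply (f := fun ω' => F (X ω) (Y ω'))
          ((hF.comp measurable_prodMk_left).comp hY) ht,
        Measure.map_apply hY (measurable_prodMk_left hT)]
      congr 1
      ext ω'
      simp [hs']
    · rw [indicator_of_notMem (show ω ∉ X ⁻¹' s from hs')]
      simp [hs']
  rw [lintegral_congr_ae e2, lintegral_indicator_const (hX hs), Measure.map_apply hX hs, mul_comm]

/-- The marginal reading of the product law. This is the conditioning device used throughout: freeze
`X`, compute the law, and observe that the frozen value does not matter. -/
lemma indepFun_and_hasLaw_of_forall_map_eq [IsProbabilityMeasure P] {A B C : Type*}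
    [MeasurableSpace A] [MeasurableSpace B] [MeasurableSpace C] {X : Ω → A} {Y : Ω → B}
    (hX : Measurable X) (hY : Measurable Y) (hXY : IndepFun X Y P) {F : A → B → C}
    (hF : Measurable (Function.uncurry F)) {ν : Measure C} [IsProbabilityMeasure ν]
    (h : ∀ᵐ ω ∂P, P.map (fun ω' => F (X ω) (Y ω')) = ν) :
    IndepFun X (fun ω => F (X ω) (Y ω)) P ∧ HasLaw (fun ω => F (X ω) (Y ω)) ν P := by
  have hm : Measurable fun ω => F (X ω) (Y ω) := hF.comp (hX.prodMk hY)
  have : IsProbabilityMeasure (P.map X) := Measure.isProbabilityMeasure_map hX.aemeasurable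
  have h1 := hasLaw_prod_of_forall_map_eq hX hY hXY hF h
  have h2 : HasLaw (fun ω => F (X ω) (Y ω)) ν P := by
    refine ⟨hm.aemeasurable, ?_⟩
    have := congrArg (Measure.map Prod.snd) h1.map_eq
    rwa [Measure.map_map measurable_snd (hX.prodMk hm), Measure.map_snd_prod, measure_univ,
      one_smul] at this
  refine ⟨?_, h2⟩
  rw [indepFun_iff_map_prod_eq_prod_map_map hX.aemeasurable hm.aemeasurable, h1.map_eq, h2.map_eq]

end Independence

/-! ### Complex normal laws -/

lemma measurable_complex_mk : Measurable fun p : ℝ × ℝ => (⟨p.1, p.2⟩ : ℂ) :=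
  Complex.measurableEquivRealProd.symm.measurable

instance (m : ℂ) (v : ℝ≥0) : IsProbabilityMeasure (complexNormal m v) :=
  Measure.isProbabilityMeasure_map measurable_complex_mk.aemeasurable

lemma charFun_complexNormal (m : ℂ) (v : ℝ≥0) (t : ℂ) :
    charFun (complexNormal m v) t =
      Complex.exp ((inner ℝ m t : ℝ) * Complex.I - ((v * ‖t‖ ^ 2 / 4 : ℝ) : ℂ)) := by
  rw [charFun_apply, complexNormal,
    integral_map measurable_complex_mk.aemeasurable (by fun_prop)]
  have h : ∀ p : ℝ × ℝ, Complex.exp ((inner ℝ (⟨p.1, p.2⟩ : ℂ) t : ℝ) * Complex.I) =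
      Complex.exp (t.re * p.1 * Complex.I) * Complex.exp (t.im * p.2 * Complex.I) := by
    intro p
    rw [← Complex.exp_add, Complex.inner]
    congr 1
    simp
    ring
  simp_rw [h]
  rw [integral_prod_mul (fun x : ℝ => Complex.exp (t.re * x * Complex.I))
    (fun y : ℝ => Complex.exp (t.im * y * Complex.I)), ← charFun_apply_real, ← charFun_apply_real,
    charFun_gaussianReal, charFun_gaussianReal, ← Complex.exp_add]
  congr 1
  rw [Complex.inner, ← Complex.normSq_eq_norm_sq, Complex.normSq_apply]
  simp
  ring

lemma charFun_map_const_mul_complex (μ : Measure ℂ) (c t : ℂ) :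
    charFun (μ.map (fun z => c * z)) t = charFun μ ((starRingEnd ℂ) c * t) := by
  rw [charFun_apply, charFun_apply, integral_map (by fun_prop) (by fun_prop)]
  congr with z
  congr 3
  simp [Complex.inner]
  ring

section ComplexNormal

variable {Ω : Type*} [MeasurableSpace Ω] {P : Measure Ω}

/-- Linear combinations of independent complex normal variables are complex normal. -/
lemma hasLaw_sum_complexNormal [IsProbabilityMeasure P] {ι : Type*} [Fintype ι] {X : ι → Ω → ℂ}
    {m : ι → ℂ} {v : ι → ℝ≥0} (hX : ∀ i, HasLaw (X i) (complexNormal (m i) (v i)) P)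
    (h : iIndepFun X P) (c : ι → ℂ) :
    HasLaw (fun ω => ∑ i, c i * X i ω) (complexNormal (∑ i, c i * m i) (∑ i, ‖c i‖₊ ^ 2 * v i))
      P := by
  have hm : ∀ i, AEMeasurable (fun ω => c i * X i ω) P := fun i =>
    (hX i).aemeasurable.const_mul _
  have : IsProbabilityMeasure (P.map (fun ω => ∑ i, c i * X i ω)) :=
    Measure.isProbabilityMeasure_map (Finset.aemeasurable_fun_sum _ fun i _ => hm i)
  refine ⟨Finset.aemeasurable_fun_sum _ fun i _ => hm i,
    Measure.ext_of_charFun (funext fun t => ?_)⟩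
  have hi : iIndepFun (fun i ω => c i * X i ω) P :=
    h.comp (fun i z => c i * z) (fun i => by fun_prop)
  rw [hi.charFun_map_fun_sum_eq_prod hm, Finset.prod_apply, charFun_complexNormal]
  have h1 : ∀ i, charFun (P.map fun ω => c i * X i ω) t =
      Complex.exp ((inner ℝ (c i * m i) t : ℝ) * Complex.I -
        ((‖c i‖ ^ 2 * v i * ‖t‖ ^ 2 / 4 : ℝ) : ℂ)) := by
    intro i
    have e : P.map (fun ω => c i * X i ω) = (complexNormal (m i) (v i)).map (fun z => c i * z) := by
      rw [← (hX i).map_eq, AEMeasurable.map_map_of_aemeasurable (by fun_prop) (hX i).aemeasurable]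
      rfl
    rw [e, charFun_map_const_mul_complex, charFun_complexNormal]
    congr 2
    · congr 2
      simp [Complex.inner]
      ring
    · simp
      ring
  simp_rw [h1, ← Complex.exp_sum, Finset.sum_sub_distrib, sum_inner]
  congr 2
  · push_cast
    rw [Finset.sum_mul]
  · push_cast
    rw [Finset.sum_mul, Finset.sum_div]

/-- The real part alone already has no atoms. -/
lemma complexNormal_singleton (m : ℂ) {v : ℝ≥0} (hv : v ≠ 0) (z : ℂ) :
    complexNormal m v {z} = 0 := by
  have := nullSingletonClass_gaussianReal (μ := m.re) (v := v / 2) (by simpa using hv)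
  rw [complexNormal, Measure.map_apply measurable_complex_mk (measurableSet_singleton _)]
  refine measure_mono_null (t := {z.re} ×ˢ univ) (fun p hp => ?_) (by simp)
  have hp' : (⟨p.1, p.2⟩ : ℂ) = z := hp
  simp [← hp']

lemma measurable_exponentialPDF {r : ℝ} : Measurable (exponentialPDF r) :=
  (measurable_exponentialPDFReal r).ennreal_ofReal

lemma charFun_expMeasure_one (t : ℝ) : charFun (expMeasure 1) t = 1 / (1 - t * Complex.I) := by
  have h : expMeasure 1 = volume.withDensity (exponentialPDF 1) := rfl
  rw [charFun_apply_real, h, integral_withDensity_eq_integral_toReal_smul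
    measurable_exponentialPDF (.of_forall fun x => ENNReal.ofReal_lt_top)]
  have e : ∀ x : ℝ, (exponentialPDF 1 x).toReal • Complex.exp (t * x * Complex.I) =
      (Ici (0 : ℝ)).indicator (fun x : ℝ => Complex.exp (-(1 - t * Complex.I) * x)) x := by
    intro x
    by_cases hx : 0 ≤ x
    · rw [indicator_of_mem (show x ∈ Ici 0 from hx), exponentialPDF_of_nonneg hx,
        ENNReal.toReal_ofReal (by positivity), Complex.real_smul]
      push_cast
      rw [one_mul, ← Complex.exp_add]
      congr 1
      ring
    · rw [indicator_of_notMem (by simpa using hx), exponentialPDF_of_neg (by simpa using hx)]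
      simp
  simp_rw [e]
  rw [integral_indicator measurableSet_Ici, integral_Ici_eq_integral_Ioi,
    integral_exp_mul_complex_Ioi (by simp)]
  rw [Complex.ofReal_zero, mul_zero, Complex.exp_zero, neg_div_neg_eq]

/-- The real and imaginary parts of a `CN(0, 1)` variable contribute equal factors to the
characteristic function of `‖z‖ ^ 2`. Only the square of this integral is needed, so the complex
square root in the Gaussian integral disappears. -/
lemma integral_gaussianReal_half_cexp_sq (t : ℝ) :
    (∫ x : ℝ, Complex.exp (t * x ^ 2 * Complex.I) ∂(gaussianReal 0 (1 / 2))) ^ 2 =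
      1 / (1 - t * Complex.I) := by
  have hre : 0 < (1 - t * Complex.I).re := by simp
  have hne : (1 - t * Complex.I) ≠ 0 := fun h => by simp [h] at hre
  rw [integral_gaussianReal_eq_integral_smul (by norm_num)]
  have e : ∀ x : ℝ, gaussianPDFReal 0 (1 / 2) x • Complex.exp (t * x ^ 2 * Complex.I) =
      ((√Real.pi)⁻¹ : ℝ) * Complex.exp (-(1 - t * Complex.I) * x ^ 2) := by
    intro x
    rw [gaussianPDFReal, Complex.real_smul]
    have h1 : (2 * Real.pi * ((1 / 2 : ℝ≥0) : ℝ)) = Real.pi := by simp; ring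
    rw [h1]
    push_cast
    rw [mul_assoc, ← Complex.exp_add]
    congr 2
    ring
  simp_rw [e]
  rw [integral_const_mul, integral_gaussian_complex hre, mul_pow, ← Complex.cpow_nat_mul]
  have h2 : ((√Real.pi)⁻¹ : ℝ) ^ 2 = Real.pi⁻¹ := by
    rw [inv_pow, Real.sq_sqrt Real.pi_pos.le]
  rw [← Complex.ofReal_pow, h2]
  have : (Real.pi : ℂ) ≠ 0 := by exact_mod_cast Real.pi_ne_zero
  norm_num
  field_simp

/-- Both characteristic functions equal `1 / (1 - it)`. -/
lemma map_norm_sq_complexNormal : (complexNormal 0 1).map (fun z => ‖z‖ ^ 2) = expMeasure 1 := by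
  have := isProbabilityMeasure_expMeasure (r := 1) one_pos
  have : IsProbabilityMeasure ((complexNormal 0 1).map (fun z => ‖z‖ ^ 2)) :=
    Measure.isProbabilityMeasure_map (by fun_prop)
  refine Measure.ext_of_charFun (funext fun t => ?_)
  rw [charFun_expMeasure_one, charFun_apply_real, integral_map (by fun_prop) (by fun_prop),
    complexNormal, integral_map measurable_complex_mk.aemeasurable (by fun_prop)]
  have h : ∀ p : ℝ × ℝ, Complex.exp (t * ((‖(⟨p.1, p.2⟩ : ℂ)‖ ^ 2 : ℝ) : ℂ) * Complex.I) =
      Complex.exp (t * p.1 ^ 2 * Complex.I) * Complex.exp (t * p.2 ^ 2 * Complex.I) := by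
    intro p
    rw [← Complex.exp_add, ← Complex.normSq_eq_norm_sq, Complex.normSq_apply]
    congr 1
    push_cast
    ring
  simp_rw [h]
  simp only [Complex.zero_re, Complex.zero_im]
  rw [integral_prod_mul (fun x : ℝ => Complex.exp (t * x ^ 2 * Complex.I))
    (fun x : ℝ => Complex.exp (t * x ^ 2 * Complex.I)), ← sq, integral_gaussianReal_half_cexp_sq]

lemma lintegral_expNeg_norm_sq_complexNormal {a : ℝ} (ha : 0 ≤ a) :
    ∫⁻ z, expNeg (ENNReal.ofReal (a * ‖z‖ ^ 2)) ∂(complexNormal 0 1) =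
      ENNReal.ofReal (1 / (1 + a)) := by
  have hm : Measurable fun x : ℝ => expNeg (ENNReal.ofReal (a * x)) :=
    measurable_expNeg.comp (by fun_prop)
  have h : expMeasure 1 = volume.withDensity (exponentialPDF 1) := rfl
  rw [← lintegral_map (f := fun x : ℝ => expNeg (ENNReal.ofReal (a * x)))
    (g := fun z : ℂ => ‖z‖ ^ 2) hm (by fun_prop), map_norm_sq_complexNormal, h,
    lintegral_withDensity_eq_lintegral_mul _ measurable_exponentialPDF hm]
  have e : ∀ x : ℝ, (exponentialPDF 1 * fun x : ℝ => expNeg (ENNReal.ofReal (a * x))) x =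
      (Ici (0 : ℝ)).indicator (fun x : ℝ => ENNReal.ofReal (Real.exp (-(1 + a) * x))) x := by
    intro x
    rw [Pi.mul_apply]
    by_cases hx : 0 ≤ x
    · rw [indicator_of_mem (show x ∈ Ici 0 from hx), exponentialPDF_of_nonneg hx,
        expNeg_ofReal (by positivity), ← ENNReal.ofReal_mul (by positivity), one_mul,
        ← Real.exp_add]
      ring_nf
    · rw [indicator_of_notMem (by simpa using hx), exponentialPDF_of_neg (by simpa using hx)]
      simp
  simp_rw [e]
  rw [lintegral_indicator measurableSet_Ici, setLIntegral_congr Ioi_ae_eq_Ici.symm,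
    ← ofReal_integral_eq_lintegral_ofReal (integrableOn_exp_mul_Ioi (by linarith) 0)
      (.of_forall fun x => by positivity),
    integral_exp_mul_Ioi (by linarith)]
  congr 1
  rw [mul_zero, Real.exp_zero, neg_div_neg_eq]

end ComplexNormal

/-! ### The Erlang distribution -/

/-- The probability that a sum of `k` independent standard exponential variables exceeds `t`. -/
def erlangTail (k : ℕ) (t : ℝ) : ℝ := Real.exp (-t) * ∑ n ∈ Finset.range k, t ^ n / n.factorial

lemma erlangTail_nonneg (k : ℕ) {t : ℝ} (ht : 0 ≤ t) : 0 ≤ erlangTail k t :=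
  mul_nonneg (Real.exp_pos _).le (Finset.sum_nonneg fun n _ => by positivity)

/-- Since `e^{-y} e^{-(t-y)} = e^{-t}`, only the powers of `t - y` are integrated. This raises each
degree by one, and the separate `e^{-t}` supplies the missing degree-zero term. -/
lemma integral_erlangTail (k : ℕ) (t : ℝ) :
    (∫ y in (0 : ℝ)..t, Real.exp (-y) * erlangTail k (t - y)) + Real.exp (-t) =
      erlangTail (k + 1) t := by
  have h1 : ∀ y : ℝ, Real.exp (-y) * erlangTail k (t - y) =
      (fun u => Real.exp (-t) * ∑ n ∈ Finset.range k, u ^ n / (n.factorial : ℝ)) (t - y) := by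
    intro y
    simp only [erlangTail]
    rw [← mul_assoc, ← Real.exp_add]
    ring_nf
  simp_rw [h1]
  rw [intervalIntegral.integral_comp_sub_left
    (fun u => Real.exp (-t) * ∑ n ∈ Finset.range k, u ^ n / (n.factorial : ℝ)),
    intervalIntegral.integral_const_mul, intervalIntegral.integral_finsetSum, erlangTail,
    Finset.sum_range_succ']
  · simp only [intervalIntegral.integral_div, integral_pow, sub_self, sub_zero]
    rw [mul_add]
    simp only [pow_zero, Nat.factorial_zero, Nat.cast_one, div_one, mul_one]
    congr 2
    refine Finset.sum_congr rfl fun n _ => ?_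
    rw [Nat.factorial_succ]
    push_cast
    simp only [ne_eq, Nat.add_eq_zero_iff, one_ne_zero, and_false, not_false_eq_true, zero_pow,
      sub_zero]
    field_simp
  · exact fun n _ => Continuous.intervalIntegrable (by fun_prop) _ _

section Erlang

variable {Ω : Type*} [MeasurableSpace Ω] {P : Measure Ω}

lemma ae_nonneg_of_hasLaw_expMeasure {W : Ω → ℝ} (hW : HasLaw W (expMeasure 1) P) :
    ∀ᵐ ω ∂P, 0 ≤ W ω := by
  rw [hW.ae_iff (p := fun x => 0 ≤ x) (measurableSet_Ici (a := (0 : ℝ))).mem]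
  have h : expMeasure 1 = volume.withDensity (exponentialPDF 1) := rfl
  rw [ae_iff, h, withDensity_apply _ (by measurability)]
  simp only [not_le]
  exact lintegral_exponentialPDF_of_nonpos le_rfl

variable [IsProbabilityMeasure P]

/-- Condition on `B = y`. For `y ≤ t` the tail of `A` at `t - y` enters; for `y > t` the event is
almost sure because `A ≥ 0`. `integral_erlangTail` adds the two parts. -/
lemma measure_add_gt_of_expMeasure {A B : Ω → ℝ} (hA : Measurable A) (hB : Measurable B)
    (hBA : IndepFun B A P) (hBlaw : HasLaw B (expMeasure 1) P) (hA0 : ∀ᵐ ω ∂P, 0 ≤ A ω) {k : ℕ}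
    (hAtail : ∀ t, 0 ≤ t → P {ω | t < A ω} = ENNReal.ofReal (erlangTail k t)) {t : ℝ}
    (ht : 0 ≤ t) : P {ω | t < B ω + A ω} = ENNReal.ofReal (erlangTail (k + 1) t) := by
  have hT : MeasurableSet {p : ℝ × ℝ | t < p.1 + p.2} :=
    measurableSet_lt measurable_const (measurable_fst.add measurable_snd)
  have hG : ∀ y, (P.map A) (Prod.mk y ⁻¹' {p : ℝ × ℝ | t < p.1 + p.2}) = P {ω | t - y < A ω} := by
    intro y
    rw [Measure.map_apply hA (measurable_prodMk_left hT)]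
    congr 1
    ext ω
    simp [sub_lt_iff_lt_add']
  have hGm : Measurable fun y => P {ω | t - y < A ω} := by
    simp_rw [← hG]
    exact measurable_measure_prodMk_left hT
  have e1 : {ω | t < B ω + A ω} = (fun ω => (B ω, A ω)) ⁻¹' {p : ℝ × ℝ | t < p.1 + p.2} := rfl
  have hexp : expMeasure 1 = volume.withDensity (exponentialPDF 1) := rfl
  rw [e1, ← Measure.map_apply (hB.prodMk hA) hT,
    (indepFun_iff_map_prod_eq_prod_map_map hB.aemeasurable hA.aemeasurable).1 hBA,
    Measure.prod_apply hT, hBlaw.map_eq]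
  simp_rw [hG]
  rw [hexp, lintegral_withDensity_eq_lintegral_mul _ measurable_exponentialPDF hGm]
  have e2 : ∀ y : ℝ, (exponentialPDF 1 * fun y => P {ω | t - y < A ω}) y =
      (Ici (0 : ℝ)).indicator (fun y => ENNReal.ofReal (Real.exp (-y)) *
        P {ω | t - y < A ω}) y := by
    intro y
    by_cases hy : 0 ≤ y
    · rw [indicator_of_mem (show y ∈ Ici 0 from hy), Pi.mul_apply, exponentialPDF_of_nonneg hy,
        one_mul, one_mul]
    · rw [indicator_of_notMem (by simpa using hy), Pi.mul_apply,
        exponentialPDF_of_neg (by simpa using hy), zero_mul]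
  simp_rw [e2]
  rw [lintegral_indicator measurableSet_Ici, ← Icc_union_Ioi_eq_Ici ht,
    lintegral_union measurableSet_Ioi (Set.disjoint_left.2 fun y hy hy' => not_lt.2 hy.2 hy')]
  have e3 : ∫⁻ y in Icc 0 t, ENNReal.ofReal (Real.exp (-y)) * P {ω | t - y < A ω} =
      ENNReal.ofReal (∫ y in (0 : ℝ)..t, Real.exp (-y) * erlangTail k (t - y)) := by
    rw [intervalIntegral.integral_of_le ht, ← integral_Icc_eq_integral_Ioc,
      ofReal_integral_eq_lintegral_ofReal]
    · refine setLIntegral_congr_fun measurableSet_Icc fun y hy => ?_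
      rw [hAtail _ (by linarith [hy.2]), ← ENNReal.ofReal_mul (Real.exp_pos _).le]
    · refine ContinuousOn.integrableOn_Icc (Continuous.continuousOn ?_)
      unfold erlangTail
      fun_prop
    · refine (ae_restrict_iff' measurableSet_Icc).2 (.of_forall fun y hy => ?_)
      exact mul_nonneg (Real.exp_pos _).le (erlangTail_nonneg _ (by linarith [hy.2]))
  have e4 : ∫⁻ y in Ioi t, ENNReal.ofReal (Real.exp (-y)) * P {ω | t - y < A ω} =
      ENNReal.ofReal (Real.exp (-t)) := by
    rw [← integral_exp_neg_Ioi t, ofReal_integral_eq_lintegral_ofReal (integrableOn_exp_neg_Ioi t)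
      (.of_forall fun y => (Real.exp_pos _).le)]
    refine setLIntegral_congr_fun measurableSet_Ioi fun y hy => ?_
    have hy' : t < y := hy
    have : P {ω | t - y < A ω} = 1 := by
      rw [prob_compl_eq_zero_iff (measurableSet_lt measurable_const hA) |>.symm]
      refine measure_mono_null (fun ω hω => ?_) (ae_iff.1 hA0)
      simp only [mem_compl_iff, mem_ofPred_eq, not_lt, not_le] at hω ⊢
      linarith
    simp only [this, mul_one]
  rw [e3, e4, ← ENNReal.ofReal_add _ (Real.exp_pos _).le, integral_erlangTail]
  exact intervalIntegral.integral_nonneg ht fun y hy =>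
    mul_nonneg (Real.exp_pos _).le (erlangTail_nonneg _ (by linarith [hy.2]))

lemma measure_sum_gt_of_expMeasure {ι : Type*} {W : ι → Ω → ℝ} (hW : ∀ i, Measurable (W i))
    (hlaw : ∀ i, HasLaw (W i) (expMeasure 1) P) (hind : iIndepFun W P) (s : Finset ι) {t : ℝ}
    (ht : 0 ≤ t) : P {ω | t < ∑ i ∈ s, W i ω} = ENNReal.ofReal (erlangTail s.card t) := by
  classical
  induction s using Finset.induction_on generalizing t with
  | empty => simp [erlangTail, not_lt.2 ht]
  | insert a s ha ih =>
    simp_rw [Finset.sum_insert ha]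
    rw [Finset.card_insert_of_notMem ha]
    refine measure_add_gt_of_expMeasure (Finset.measurable_fun_sum _ fun i _ => hW i) (hW a)
      ?_ (hlaw a) ?_ (fun t ht => ih ht) ht
    · have := (hind.indepFun_finsetSum_of_notMem hW ha).symm
      convert! this using 1
      ext ω
      simp
    · filter_upwards [(Filter.eventually_all_finset s).2 fun i _ =>
        ae_nonneg_of_hasLaw_expMeasure (hlaw i)] with ω hω
      exact Finset.sum_nonneg hω

end Erlang

/-! ### Projections of complex Gaussian vectors -/

/-- The law of a vector of independent standard complex normal variables. -/
def stdComplexNormal (n : ℕ) : Measure (EuclideanSpace ℂ (Fin n)) :=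
  (Measure.pi fun _ : Fin n => complexNormal 0 1).map (WithLp.toLp 2)

instance (n : ℕ) : IsProbabilityMeasure (stdComplexNormal n) :=
  Measure.isProbabilityMeasure_map (by fun_prop)

lemma charFun_stdComplexNormal (n : ℕ) (t : EuclideanSpace ℂ (Fin n)) :
    charFun (stdComplexNormal n) t = Complex.exp (-((‖t‖ ^ 2 / 4 : ℝ) : ℂ)) := by
  rw [stdComplexNormal, charFun_pi]
  simp_rw [charFun_complexNormal]
  rw [← Complex.exp_sum]
  congr 1
  rw [EuclideanSpace.norm_sq_eq]
  simp [Finset.sum_div]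

/-- The characteristic function depends only on the norm of its argument, and isometries preserve
that norm. -/
lemma map_linearIsometryEquiv_stdComplexNormal {n : ℕ}
    (U : EuclideanSpace ℂ (Fin n) ≃ₗᵢ[ℂ] EuclideanSpace ℂ (Fin n)) :
    (stdComplexNormal n).map U = stdComplexNormal n := by
  have hU : Measurable U := U.continuous.measurable
  have : IsProbabilityMeasure ((stdComplexNormal n).map U) :=
    Measure.isProbabilityMeasure_map hU.aemeasurable
  refine Measure.ext_of_charFun (funext fun t => ?_)
  have h : charFun ((stdComplexNormal n).map U) t = charFun (stdComplexNormal n) (U.symm t) := by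
    rw [charFun_apply, charFun_apply, integral_map hU.aemeasurable (by fun_prop)]
    -- Characteristic functions use the real inner product, whereas the adjoint identity for `U`
    -- concerns the complex one.
    have hre : ∀ x y : EuclideanSpace ℂ (Fin n), inner ℝ x y = (inner ℂ x y).re := by
      intro x y
      simp [PiLp.inner_apply, Complex.inner]
    congr with x
    rw [hre, hre, U.inner_map_eq_flip]
  rw [h, charFun_stdComplexNormal, charFun_stdComplexNormal, U.symm.norm_map]

lemma starProjection_orthogonal_singleton {n : ℕ} (q h : EuclideanSpace ℂ (Fin n)) :
    ((Submodule.span ℂ {q})ᗮ).starProjection h =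
      h - (inner ℂ q h / ((‖q‖ ^ 2 : ℝ) : ℂ)) • q := by
  rw [Submodule.starProjection_orthogonal_val, Submodule.starProjection_singleton]
  rfl

/-- Extend `q / ‖q‖`, placed at index `i`, to an orthonormal basis, and let `U` be the coordinate
map. Projecting away from `q` deletes the `i`-th coordinate. -/
lemma norm_sq_starProjection_orthogonal_singleton {n : ℕ} {q : EuclideanSpace ℂ (Fin n)}
    (hq : q ≠ 0) (i : Fin n) :
    ∃ U : EuclideanSpace ℂ (Fin n) ≃ₗᵢ[ℂ] EuclideanSpace ℂ (Fin n), ∀ h,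
      ‖((Submodule.span ℂ {q})ᗮ).starProjection h‖ ^ 2 =
        ∑ j ∈ Finset.univ.erase i, ‖U h j‖ ^ 2 := by
  have hq' : ‖q‖ ≠ 0 := norm_ne_zero_iff.2 hq
  have hv : Orthonormal ℂ (({i} : Set (Fin n)).domRestrict
      fun _ => (((‖q‖⁻¹ : ℝ) : ℂ) • q : EuclideanSpace ℂ (Fin n))) := by
    refine ⟨fun j => ?_, fun j k hjk => (hjk (Subsingleton.elim _ _)).elim⟩
    simp [norm_smul, hq']
  obtain ⟨b, hb⟩ := hv.exists_orthonormalBasis_extension_of_card_eq (by simp)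
  refine ⟨b.repr, fun h => ?_⟩
  have h1 := Submodule.norm_sq_eq_add_norm_sq_starProjection h (Submodule.span ℂ {q})
  have h2 : ‖h‖ ^ 2 = ∑ j, ‖b.repr h j‖ ^ 2 := by
    rw [← b.repr.norm_map h, EuclideanSpace.norm_sq_eq]
  have h3 : ‖(Submodule.span ℂ {q}).starProjection h‖ ^ 2 = ‖b.repr h i‖ ^ 2 := by
    rw [Submodule.starProjection_singleton, b.repr_apply_apply, hb i rfl, inner_smul_left]
    simp only [norm_smul, norm_div, norm_mul]
    simp
    field_simp
  rw [h2, h3, ← Finset.add_sum_erase _ _ (Finset.mem_univ i)] at h1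
  linarith

/-- The law of the squared norm of the projection of a standard complex normal vector to the
orthogonal complement of a line. -/
lemma map_norm_sq_starProjection_stdComplexNormal {n : ℕ} {q : EuclideanSpace ℂ (Fin n)}
    (hq : q ≠ 0) (i : Fin n) :
    (stdComplexNormal n).map (fun h => ‖((Submodule.span ℂ {q})ᗮ).starProjection h‖ ^ 2) =
      (stdComplexNormal n).map (fun z => ∑ j ∈ Finset.univ.erase i, ‖z j‖ ^ 2) := by
  obtain ⟨U, hU⟩ := norm_sq_starProjection_orthogonal_singleton hq i
  simp_rw [hU]
  conv_rhs => rw [← map_linearIsometryEquiv_stdComplexNormal U]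
  rw [Measure.map_map (by fun_prop) U.continuous.measurable]
  rfl

lemma map_sum_norm_sq_stdComplexNormal_Ioi {n : ℕ} (s : Finset (Fin n)) {t : ℝ} (ht : 0 ≤ t) :
    (stdComplexNormal n).map (fun z => ∑ j ∈ s, ‖z j‖ ^ 2) (Ioi t) =
      ENNReal.ofReal (erlangTail s.card t) := by
  rw [stdComplexNormal, Measure.map_map (by fun_prop) (by fun_prop),
    Measure.map_apply (by fun_prop) measurableSet_Ioi]
  have hind : iIndepFun (fun (j : Fin n) (z : Fin n → ℂ) => ‖z j‖ ^ 2)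
      (Measure.pi fun _ : Fin n => complexNormal 0 1) :=
    iIndepFun_pi (X := fun _ z => ‖z‖ ^ 2) fun _ => by fun_prop
  refine measure_sum_gt_of_expMeasure (fun j => by fun_prop)
    (fun j => ⟨Measurable.aemeasurable (by fun_prop), ?_⟩) hind s ht
  rw [← map_norm_sq_complexNormal]
  conv_rhs => rw [← (measurePreserving_eval (fun _ : Fin n => complexNormal 0 1) j).map_eq]
  rw [Measure.map_map (by fun_prop) (by fun_prop)]
  rfl

/-! ### Consequences of independence -/

section Independence

variable {Ω : Type*} [MeasurableSpace Ω] {P : Measure Ω} [IsProbabilityMeasure P]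

/-- Group the indices by the proposition "lies in the range of `a`": the two families sit in the
fibers over `True` and `False`. -/
lemma indepFun_of_disjoint {ι A B E : Type*} [MeasurableSpace E] {X : ι → Ω → E}
    (hX : ∀ i, Measurable (X i)) (h : iIndepFun X P) (a : A → ι) (b : B → ι)
    (hab : ∀ x y, a x ≠ b y) :
    IndepFun (fun ω x => X (a x) ω) (fun ω y => X (b y) ω) P := by
  have h1 := (iIndepFun_fibers hX h (fun i => ∃ x, a x = i)).indepFun
    (i := True) (j := False) (by simp)
  exact h1.comp
    (φ := fun f x => f ⟨a x, eq_true ⟨x, rfl⟩⟩)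
    (ψ := fun f y => f ⟨b y, eq_false fun ⟨x, hx⟩ => hab x y hx⟩)
    (by fun_prop) (by fun_prop)

/-- The hypotheses make the joint law a triple product, whose factors may be reordered by Tonelli.
It serves to isolate the typical station's own coefficients from everything else. -/
lemma indepFun_left_comm {A B C : Type*} [MeasurableSpace A] [MeasurableSpace B]
    [MeasurableSpace C] {X : Ω → A} {Y : Ω → B} {Z : Ω → C} (hX : Measurable X)
    (hY : Measurable Y) (hZ : Measurable Z) (h : IndepFun X (fun ω => (Y ω, Z ω)) P)
    (hYZ : IndepFun Y Z P) : IndepFun Y (fun ω => (X ω, Z ω)) P := by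
  have := Measure.isProbabilityMeasure_map (μ := P) hX.aemeasurable
  have := Measure.isProbabilityMeasure_map (μ := P) hY.aemeasurable
  have := Measure.isProbabilityMeasure_map (μ := P) hZ.aemeasurable
  have hXZ : IndepFun X Z P := h.comp measurable_id measurable_snd
  rw [indepFun_iff_map_prod_eq_prod_map_map hX.aemeasurable (hY.prodMk hZ).aemeasurable,
    (indepFun_iff_map_prod_eq_prod_map_map hY.aemeasurable hZ.aemeasurable).1 hYZ] at h
  rw [indepFun_iff_map_prod_eq_prod_map_map hY.aemeasurable (hX.prodMk hZ).aemeasurable,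
    (indepFun_iff_map_prod_eq_prod_map_map hX.aemeasurable hZ.aemeasurable).1 hXZ]
  refine Measure.ext_of_lintegral _ fun f hf => ?_
  have h2 : ∫⁻ p, f p ∂(P.map fun ω => (Y ω, X ω, Z ω)) =
      ∫⁻ p, f (p.2.1, p.1, p.2.2) ∂(P.map fun ω => (X ω, Y ω, Z ω)) := by
    rw [lintegral_map hf (hY.prodMk (hX.prodMk hZ)),
      lintegral_map (by fun_prop) (hX.prodMk (hY.prodMk hZ))]
  rw [h2, h, lintegral_prod _ (by fun_prop), lintegral_prod _ (by fun_prop)]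
  have h3 : ∀ a, ∫⁻ q : B × C, f (q.1, a, q.2) ∂((P.map Y).prod (P.map Z)) =
      ∫⁻ b, ∫⁻ c, f (b, a, c) ∂(P.map Z) ∂(P.map Y) := fun a =>
    lintegral_prod _ (by fun_prop)
  have h4 : ∀ b, ∫⁻ q : A × C, f (b, q) ∂((P.map X).prod (P.map Z)) =
      ∫⁻ a, ∫⁻ c, f (b, a, c) ∂(P.map Z) ∂(P.map X) := fun b =>
    lintegral_prod _ (by fun_prop)
  simp_rw [h3, h4]
  rw [lintegral_lintegral_swap]
  exact (Measurable.lintegral_prod_right' (f := fun q : (A × B) × C => f (q.1.2, q.1.1, q.2))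
    (by fun_prop)).aemeasurable

lemma ae_of_indepFun_of_ae_ae {A B : Type*} [MeasurableSpace A] [MeasurableSpace B] {X : Ω → A}
    {Y : Ω → B} (hX : Measurable X) (hY : Measurable Y) (hXY : IndepFun X Y P)
    {p : A × B → Prop} (hp : MeasurableSet {x | p x})
    (h : ∀ᵐ ω ∂P, ∀ᵐ ω' ∂P, p (X ω, Y ω')) : ∀ᵐ ω ∂P, p (X ω, Y ω) := by
  have := Measure.isProbabilityMeasure_map (μ := P) hX.aemeasurable
  have := Measure.isProbabilityMeasure_map (μ := P) hY.aemeasurable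
  rw [← ae_map_iff (p := p) (hX.prodMk hY).aemeasurable hp,
    (indepFun_iff_map_prod_eq_prod_map_map hX.aemeasurable hY.aemeasurable).1 hXY,
    Measure.ae_prod_iff_ae_ae hp, ae_map_iff hX.aemeasurable]
  · filter_upwards [h] with ω hω
    exact (ae_map_iff (p := fun y => p (X ω, y)) hY.aemeasurable (measurable_prodMk_left hp)).2 hω
  · exact measurable_measure_prodMk_left hp.compl (measurableSet_singleton 0)

end Independence


/-! ### The combiner and the effective channels as functions of the channel coefficients -/

section Deterministic

variable {n M : ℕ}

/-- The product of a channel matrix with the maximum ratio transmission vector of a channel. -/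
def beamformed (H : Fin n → Fin M → ℂ) (d : Fin M → ℂ) : EuclideanSpace ℂ (Fin n) :=
  WithLp.toLp 2 (Matrix.of H *ᵥ
    WithLp.ofLp (((‖(WithLp.toLp 2 d : EuclideanSpace ℂ (Fin M))‖⁻¹ : ℝ) : ℂ) •
      (WithLp.toLp 2 d : EuclideanSpace ℂ (Fin M))))

/-- The maximum ratio transmission vector of a channel. -/
def mrt (d : Fin M → ℂ) (j : Fin M) : ℂ :=
  ((‖(WithLp.toLp 2 d : EuclideanSpace ℂ (Fin M))‖⁻¹ : ℝ) : ℂ) * d j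

lemma beamformed_apply (H : Fin n → Fin M → ℂ) (d : Fin M → ℂ) (i : Fin n) :
    beamformed H d i = ∑ j, mrt d j * H i j := by
  simp only [beamformed, Matrix.mulVec, dotProduct, Matrix.of_apply, mrt]
  exact Finset.sum_congr rfl fun j _ => by simp [mul_comm]

lemma measurable_mrt (j : Fin M) : Measurable fun d : Fin M → ℂ => mrt d j := by
  unfold mrt
  fun_prop

lemma measurable_beamformed {A : Type*} [MeasurableSpace A] {H : A → Fin n → Fin M → ℂ}
    {d : A → Fin M → ℂ} (hH : Measurable H) (hd : Measurable d) :
    Measurable fun a => beamformed (H a) (d a) := by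
  have h : ∀ a, beamformed (H a) (d a) =
      WithLp.toLp 2 fun i => ∑ j, mrt (d a) j * H a i j := fun a => by
    ext i
    simp [beamformed_apply]
  simp_rw [h]
  refine (WithLp.measurable_toLp 2 _).comp (measurable_pi_lambda _ fun i => ?_)
  refine Finset.measurable_fun_sum _ fun j _ => ?_
  exact ((measurable_mrt j).comp hd).mul (by fun_prop)

/-- The beam is a unit vector, so beamforming preserves the variance of the channel entries. -/
lemma sum_nnnorm_mrt_sq {d : Fin M → ℂ} (hd : d ≠ 0) : ∑ j, ‖mrt d j‖₊ ^ 2 = 1 := by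
  have h0 : (WithLp.toLp 2 d : EuclideanSpace ℂ (Fin M)) ≠ 0 := by simpa using hd
  have h1 : ‖(WithLp.toLp 2 d : EuclideanSpace ℂ (Fin M))‖ ≠ 0 := norm_ne_zero_iff.2 h0
  rw [← NNReal.coe_inj]
  push_cast
  simp only [mrt, norm_mul, mul_pow, ← Finset.mul_sum]
  have := EuclideanSpace.norm_sq_eq (WithLp.toLp 2 d : EuclideanSpace ℂ (Fin M))
  simp only at this
  rw [← this]
  simp
  field_simp

/-- For fixed `v` and `d` this is a linear combination of the entries of `H`, the form required by
`hasLaw_sum_complexNormal`. -/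
lemma inner_beamformed (v : EuclideanSpace ℂ (Fin n)) (H : Fin n → Fin M → ℂ) (d : Fin M → ℂ) :
    inner ℂ v (beamformed H d) =
      ∑ p : Fin n × Fin M, ((starRingEnd ℂ) (v p.1) * mrt d p.2) * H p.1 p.2 := by
  rw [PiLp.inner_apply, Fintype.sum_prod_type]
  refine Finset.sum_congr rfl fun i _ => ?_
  rw [beamformed_apply, RCLike.inner_apply, Finset.sum_mul]
  exact Finset.sum_congr rfl fun j _ => by ring

lemma partialZeroForcing_const (q h : EuclideanSpace ℂ (Fin n)) :
    partialZeroForcing (fun _ : Fin 1 => q) h =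
      ((‖((Submodule.span ℂ {q})ᗮ).starProjection h‖⁻¹ : ℝ) : ℂ) •
        ((Submodule.span ℂ {q})ᗮ).starProjection h := by
  simp only [partialZeroForcing, range_const]

lemma measurable_starProjection_orthogonal_singleton {A : Type*} [MeasurableSpace A]
    {q h : A → EuclideanSpace ℂ (Fin n)} (hq : Measurable q) (hh : Measurable h) :
    Measurable fun a => ((Submodule.span ℂ {q a})ᗮ).starProjection (h a) := by
  simp_rw [starProjection_orthogonal_singleton]
  fun_prop

lemma measurable_partialZeroForcing_const {A : Type*} [MeasurableSpace A]
    {q h : A → EuclideanSpace ℂ (Fin n)} (hq : Measurable q) (hh : Measurable h) :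
    Measurable fun a => partialZeroForcing (fun _ : Fin 1 => q a) (h a) := by
  simp_rw [partialZeroForcing_const]
  have := measurable_starProjection_orthogonal_singleton hq hh
  fun_prop

lemma inner_partialZeroForcing_const (q h : EuclideanSpace ℂ (Fin n)) :
    inner ℂ (partialZeroForcing (fun _ : Fin 1 => q) h) q = 0 := by
  rw [partialZeroForcing_const, inner_smul_left]
  have : inner ℂ (((Submodule.span ℂ {q})ᗮ).starProjection h) q = 0 := by
    rw [inner_eq_zero_symm]
    exact Submodule.inner_right_of_mem_orthogonal (Submodule.mem_span_singleton_self q)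
      (Submodule.starProjection_apply_mem _ _)
  rw [this, mul_zero]

/-- With `u` the projection of `h`, one has `⟨u, h⟩ = ‖u‖²`, because `h - u` is orthogonal to `u`.
The case `u = 0` is consistent since then `‖u‖⁻¹ = 0`. -/
lemma norm_sq_inner_partialZeroForcing_const (q h : EuclideanSpace ℂ (Fin n)) :
    ‖inner ℂ (partialZeroForcing (fun _ : Fin 1 => q) h) h‖ ^ 2 =
      ‖((Submodule.span ℂ {q})ᗮ).starProjection h‖ ^ 2 := by
  rw [partialZeroForcing_const, inner_smul_left]
  set u := ((Submodule.span ℂ {q})ᗮ).starProjection h with hu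
  have h1 : inner ℂ u h = ((‖u‖ ^ 2 : ℝ) : ℂ) := by
    have h2 : inner ℂ u (h - u) = 0 :=
      Submodule.inner_right_of_mem_orthogonal (K := (Submodule.span ℂ {q})ᗮ)
        (Submodule.starProjection_apply_mem _ _) (Submodule.sub_starProjection_mem_orthogonal h)
    rw [inner_sub_right, sub_eq_zero, inner_self_eq_norm_sq_to_K] at h2
    rw [h2]
    simp
  rw [h1]
  by_cases hu0 : ‖u‖ = 0
  · simp [hu0]
  · simp
    field_simp

lemma norm_partialZeroForcing_const {q h : EuclideanSpace ℂ (Fin n)}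
    (hu : 0 < ‖((Submodule.span ℂ {q})ᗮ).starProjection h‖ ^ 2) :
    ‖partialZeroForcing (fun _ : Fin 1 => q) h‖ = 1 := by
  rw [partialZeroForcing_const, norm_smul]
  have : ‖((Submodule.span ℂ {q})ᗮ).starProjection h‖ ≠ 0 := fun h0 => by
    rw [h0] at hu
    simp at hu
  rw [Complex.norm_real, norm_inv, norm_norm, inv_mul_cancel₀ this]

end Deterministic

/-! ### The joint law of the gains -/

/-- The base station that a channel coefficient belongs to. -/
def ChannelEntry.station {NR NT : ℕ} : ChannelEntry NR NT → Option ℕ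
  | .bs k _ _ => k
  | .ul k _ => k
  | .dl k _ => k

/-- The group of a channel coefficient: the effective channel from a base station other than the
typical one, or the channel from its uplink node. -/
def ChannelEntry.group {NR NT : ℕ} : ChannelEntry NR NT → Option (ℕ ⊕ ℕ)
  | .bs k _ _ => k.map .inl
  | .ul k _ => k.map .inr
  | .dl k _ => k.map .inl

/-- The gains of the effective channels and the uplink channels of the other base stations, for
the receive combining vector `v`. -/
def gains {NR NT : ℕ} (v : EuclideanSpace ℂ (Fin NR))
    (y : {c : ChannelEntry NR NT // c.station ≠ none} → ℂ) : ℕ ⊕ ℕ → ℂ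
  | .inl i => inner ℂ v (beamformed (fun a b => y ⟨.bs (some i) a b, Option.some_ne_none i⟩)
      (fun j => y ⟨.dl (some i) j, Option.some_ne_none i⟩))
  | .inr i => inner ℂ v (WithLp.toLp 2 fun a => y ⟨.ul (some i) a, Option.some_ne_none i⟩)

lemma measurable_gains {NR NT : ℕ} {A : Type*} [MeasurableSpace A]
    {v : A → EuclideanSpace ℂ (Fin NR)}
    {y : A → {c : ChannelEntry NR NT // c.station ≠ none} → ℂ} (hv : Measurable v)
    (hy : Measurable y) : Measurable fun a => gains (v a) (y a) := by
  refine measurable_pi_lambda _ fun k => ?_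
  rcases k with i | i <;> simp only [gains]
  · exact hv.inner (measurable_beamformed (by fun_prop) (by fun_prop))
  · exact hv.inner (by fun_prop)

namespace Network

variable {NR NT : ℕ} {Ω : Type*}

/-- The channel coefficients that belong to the typical base station. -/
def ownChan (N : Network NR NT Ω) (ω : Ω) : {c : ChannelEntry NR NT // c.station = none} → ℂ :=
  fun c => N.chan c ω

/-- The channel coefficients that belong to the other base stations. -/
def otherChan (N : Network NR NT Ω) (ω : Ω) : {c : ChannelEntry NR NT // c.station ≠ none} → ℂ :=
  fun c => N.chan c ω

lemma effChannel_eq (N : Network NR NT Ω) (k : Option ℕ) (ω : Ω) :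
    N.effChannel k ω = beamformed (fun i j => N.chan (.bs k i j) ω) (fun j => N.chan (.dl k j) ω) :=
  rfl

/-- Orthogonality holds for every outcome, including degenerate ones where the combiner is zero. -/
lemma bsPower_none (N : Network NR NT Ω) (ω : Ω) : N.bsPower none ω = 0 := by
  simp [bsPower, combiner, inner_partialZeroForcing_const]

/-- The receive combining vector as a function of the channel coefficients of the typical base
station. -/
def combinerFun (x : {c : ChannelEntry NR NT // c.station = none} → ℂ) :
    EuclideanSpace ℂ (Fin NR) :=
  partialZeroForcing (fun _ : Fin 1 => beamformed (fun i j => x ⟨.bs none i j, rfl⟩)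
    (fun j => x ⟨.dl none j, rfl⟩)) (WithLp.toLp 2 fun i => x ⟨.ul none i, rfl⟩)

lemma measurable_combinerFun : Measurable (combinerFun (NR := NR) (NT := NT)) :=
  measurable_partialZeroForcing_const (measurable_beamformed (by fun_prop) (by fun_prop))
    (by fun_prop)

lemma combiner_eq (N : Network NR NT Ω) (ω : Ω) : N.combiner ω = combinerFun (N.ownChan ω) := rfl

/-- The gains of the other base stations and their uplink nodes after combining. -/
def gain (N : Network NR NT Ω) (ω : Ω) : ℕ ⊕ ℕ → ℂ := gains (N.combiner ω) (N.otherChan ω)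

lemma gain_eq (N : Network NR NT Ω) (ω : Ω) :
    N.gain ω = gains (combinerFun (N.ownChan ω)) (N.otherChan ω) := rfl

lemma ulPower_none_eq (N : Network NR NT Ω) (ω : Ω) : N.ulPower none ω =
    ‖inner ℂ (combinerFun (N.ownChan ω)) (WithLp.toLp 2 fun i => N.ownChan ω ⟨.ul none i, rfl⟩ :
      EuclideanSpace ℂ (Fin NR))‖ ^ 2 := rfl

attribute [local irreducible] beamformed

lemma ulPower_none (N : Network NR NT Ω) (ω : Ω) : N.ulPower none ω =
    ‖((Submodule.span ℂ {N.effChannel none ω})ᗮ).starProjection (N.ulChannel none ω)‖ ^ 2 :=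
  norm_sq_inner_partialZeroForcing_const _ _

variable [MeasurableSpace Ω] {P : Measure Ω} {N : Network NR NT Ω}
  {lam K Att : ℝ} {m : Fin NR → Fin NT → ℂ}

lemma IsModel.ae_dlChannel_ne_zero (hN : N.IsModel P lam K Att m) (hNT : 1 ≤ NT) (k : Option ℕ) :
    ∀ᵐ ω ∂P, (fun j => N.chan (.dl k j) ω) ≠ 0 := by
  have h := hN.law_chan (.dl k ⟨0, hNT⟩)
  have h1 : ∀ᵐ ω ∂P, N.chan (.dl k ⟨0, hNT⟩) ω ≠ 0 := by
    rw [h.ae_iff (p := fun z => z ≠ 0) (measurableSet_singleton (0 : ℂ)).compl.mem, ae_iff]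
    simp only [not_not]
    exact complexNormal_singleton _ one_ne_zero 0
  filter_upwards [h1] with ω hω h0
  exact hω (congrFun h0 _)

lemma IsModel.measurable_ulChannel (hN : N.IsModel P lam K Att m) (k : Option ℕ) :
    Measurable (N.ulChannel k) :=
  (WithLp.measurable_toLp 2 _).comp (measurable_pi_lambda _ fun _ => hN.measurable_chan _)

lemma IsModel.measurable_effChannel (hN : N.IsModel P lam K Att m) (k : Option ℕ) :
    Measurable (N.effChannel k) := by
  simp_rw [funext fun ω => N.effChannel_eq k ω]
  exact measurable_beamformed
    (measurable_pi_lambda _ fun _ => measurable_pi_lambda _ fun _ => hN.measurable_chan _)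
    (measurable_pi_lambda _ fun _ => hN.measurable_chan _)

lemma IsModel.measurable_ownChan (hN : N.IsModel P lam K Att m) : Measurable N.ownChan :=
  measurable_pi_lambda _ fun _ => hN.measurable_chan _

lemma IsModel.measurable_otherChan (hN : N.IsModel P lam K Att m) : Measurable N.otherChan :=
  measurable_pi_lambda _ fun _ => hN.measurable_chan _

lemma IsModel.hasLaw_ulChannel (hN : N.IsModel P lam K Att m) (k : Option ℕ) :
    HasLaw (N.ulChannel k) (stdComplexNormal NR) P := by
  have h := (hN.indep_chan.precomp (g := fun i : Fin NR => ChannelEntry.ul (NT := NT) k i)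
    (fun i j h => by simpa using h)).hasLaw_pi (fun i => hN.law_chan (.ul k i))
  refine ⟨(hN.measurable_ulChannel k).aemeasurable, ?_⟩
  have h2 := congrArg (Measure.map (WithLp.toLp 2)) h.map_eq
  rw [Measure.map_map (by fun_prop)
    (measurable_pi_lambda _ fun i => hN.measurable_chan _)] at h2
  exact h2

variable [IsProbabilityMeasure P]

lemma IsModel.indepFun_dl_bs (hN : N.IsModel P lam K Att m) (k : Option ℕ) :
    IndepFun (fun ω j => N.chan (.dl k j) ω) (fun ω i j => N.chan (.bs k i j) ω) P :=
  (indepFun_of_disjoint hN.measurable_chan hN.indep_chan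
    (fun j : Fin NT => ChannelEntry.dl (NR := NR) k j)
    (fun p : Fin NR × Fin NT => ChannelEntry.bs k p.1 p.2) (by simp)).comp
    (φ := id) (ψ := fun (f : Fin NR × Fin NT → ℂ) i j => f (i, j)) measurable_id (by fun_prop)

lemma IsModel.indepFun_effChannel_ulChannel (hN : N.IsModel P lam K Att m) (k : Option ℕ) :
    IndepFun (N.effChannel k) (N.ulChannel k) P := by
  have h := indepFun_of_disjoint hN.measurable_chan hN.indep_chan
    (Sum.elim (fun p : Fin NR × Fin NT => ChannelEntry.bs k p.1 p.2) (fun j => .dl k j))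
    (fun i : Fin NR => ChannelEntry.ul k i) (by rintro (_ | _) _ <;> simp)
  simp_rw [funext fun ω => N.effChannel_eq k ω]
  exact h.comp (φ := fun f => beamformed (fun i j => f (.inl (i, j))) (fun j => f (.inr j)))
    (ψ := fun f : Fin NR → ℂ => (WithLp.toLp 2 f : EuclideanSpace ℂ (Fin NR)))
    (measurable_beamformed (by fun_prop) (by fun_prop)) (by fun_prop)

/-- Freeze the downlink channel, hence the beam. The product is then a centred complex normal of
variance `∑ |v_a|² |w_j|² = 1`, whatever the beam is. -/
lemma IsModel.hasLaw_inner_effChannel (hN : N.IsModel P lam K Att m) (hNT : 1 ≤ NT) (i : ℕ)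
    {v : EuclideanSpace ℂ (Fin NR)} (hv : ‖v‖ = 1) :
    HasLaw (fun ω => inner ℂ v (N.effChannel (some i) ω)) (complexNormal 0 1) P := by
  simp_rw [effChannel_eq]
  refine (indepFun_and_hasLaw_of_forall_map_eq
    (F := fun d H => inner ℂ v (beamformed H d))
    (measurable_pi_lambda _ fun j => hN.measurable_chan (.dl (some i) j))
    (measurable_pi_lambda _ fun a => measurable_pi_lambda _ fun j =>
      hN.measurable_chan (.bs (some i) a j))
    (hN.indepFun_dl_bs (some i)) ?_ ?_).2
  · exact Measurable.inner measurable_const (measurable_beamformed measurable_snd measurable_fst)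
  · filter_upwards [hN.ae_dlChannel_ne_zero hNT (some i)] with ω hω
    have h := hasLaw_sum_complexNormal (P := P)
      (X := fun (p : Fin NR × Fin NT) ω' => N.chan (.bs (some i) p.1 p.2) ω')
      (fun p => hN.law_chan (.bs (some i) p.1 p.2))
      (hN.indep_chan.precomp (g := fun p : Fin NR × Fin NT => ChannelEntry.bs (some i) p.1 p.2)
        (fun p q h => by simpa [Prod.ext_iff] using h))
      (fun p => (starRingEnd ℂ) (v p.1) * mrt (fun j => N.chan (.dl (some i) j) ω) p.2)
    simp_rw [inner_beamformed]
    rw [h.map_eq]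
    congr 1
    · simp [ChannelEntry.mean]
    · simp only [ChannelEntry.var, mul_one, nnnorm_mul, mul_pow, Fintype.sum_prod_type,
        ← Finset.mul_sum, sum_nnnorm_mrt_sq hω]
      rw [← NNReal.coe_inj]
      have := EuclideanSpace.norm_sq_eq v
      rw [hv] at this
      simpa using this.symm

lemma IsModel.hasLaw_inner_ulChannel (hN : N.IsModel P lam K Att m) (i : ℕ)
    {v : EuclideanSpace ℂ (Fin NR)} (hv : ‖v‖ = 1) :
    HasLaw (fun ω => inner ℂ v (N.ulChannel (some i) ω)) (complexNormal 0 1) P := by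
  have h := hasLaw_sum_complexNormal (P := P)
    (X := fun (a : Fin NR) ω' => N.chan (.ul (some i) a) ω')
    (fun a => hN.law_chan (.ul (some i) a))
    (hN.indep_chan.precomp (g := fun a : Fin NR => ChannelEntry.ul (NT := NT) (some i) a)
      (fun p q h => by simpa using h)) (fun a => (starRingEnd ℂ) (v a))
  convert! h using 1
  · ext ω
    simp [PiLp.inner_apply, ulChannel, mul_comm]
  · congr 1
    · simp [ChannelEntry.mean]
    · rw [← NNReal.coe_inj]
      have := EuclideanSpace.norm_sq_eq v
      rw [hv] at this
      simpa [ChannelEntry.var] using this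

/-- For a deterministic `v`, different gains use disjoint groups of coefficients. The group `none`,
which collects the typical station's coefficients, is discarded. -/
lemma IsModel.iIndepFun_gains (hN : N.IsModel P lam K Att m) (v : EuclideanSpace ℂ (Fin NR)) :
    iIndepFun (fun k ω => gains v (N.otherChan ω) k) P := by
  have h := (iIndepFun_fibers hN.measurable_chan hN.indep_chan ChannelEntry.group).precomp
    (g := (some : ℕ ⊕ ℕ → Option (ℕ ⊕ ℕ))) (Option.some_injective _)
  let F : ∀ k : ℕ ⊕ ℕ, ({c : ChannelEntry NR NT // c.group = some k} → ℂ) → ℂ := fun k =>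
    match k with
    | .inl i => fun y => inner ℂ v (beamformed (fun a b => y ⟨.bs (some i) a b, rfl⟩)
        (fun j => y ⟨.dl (some i) j, rfl⟩))
    | .inr i => fun y => inner ℂ v (WithLp.toLp 2 fun a => y ⟨.ul (some i) a, rfl⟩)
  have hF : ∀ k, Measurable (F k) := by
    rintro (i | i)
    · exact Measurable.inner measurable_const
        (measurable_beamformed (by fun_prop) (by fun_prop))
    · exact Measurable.inner measurable_const ((WithLp.measurable_toLp 2 _).comp (by fun_prop))
  have h2 := h.comp F hF
  convert! h2 using 1
  ext k ω
  rcases k with i | i <;> rfl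

lemma IsModel.hasLaw_gains (hN : N.IsModel P lam K Att m) (hNT : 1 ≤ NT)
    {v : EuclideanSpace ℂ (Fin NR)} (hv : ‖v‖ = 1) :
    HasLaw (fun ω => gains v (N.otherChan ω))
      (Measure.infinitePi fun _ => complexNormal 0 1) P := by
  refine (hN.iIndepFun_gains v).hasLaw_infinitePi (fun k => ?_)
    (measurable_gains measurable_const hN.measurable_otherChan).aemeasurable
  rcases k with i | i
  · have h := hN.hasLaw_inner_effChannel hNT i hv
    simp_rw [effChannel_eq] at h
    exact h
  · exact hN.hasLaw_inner_ulChannel i hv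

/-- Given the beam, a single coordinate is already complex normal with variance `Att / (K + 1) > 0`,
whatever its Rician mean, and so has no atom at zero. -/
lemma IsModel.ae_effChannel_none_ne_zero (hN : N.IsModel P lam K Att m) (hNR : 1 ≤ NR)
    (hNT : 1 ≤ NT) (hK : 0 ≤ K) (hAtt : 0 < Att) : ∀ᵐ ω ∂P, N.effChannel none ω ≠ 0 := by
  let i : Fin NR := ⟨0, hNR⟩
  have hB : Measurable fun p : (Fin NT → ℂ) × (Fin NR → Fin NT → ℂ) => beamformed p.2 p.1 i :=
    (measurable_pi_apply i).comp ((WithLp.measurable_ofLp 2 _).comp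
      (measurable_beamformed measurable_snd measurable_fst))
  have h : ∀ᵐ ω ∂P, beamformed (fun i j => N.chan (.bs none i j) ω)
      (fun j => N.chan (.dl none j) ω) i ≠ 0 := by
    refine ae_of_indepFun_of_ae_ae (p := fun p => beamformed p.2 p.1 i ≠ 0)
      (measurable_pi_lambda _ fun j => hN.measurable_chan (.dl none j))
      (measurable_pi_lambda _ fun a => measurable_pi_lambda _ fun j =>
        hN.measurable_chan (.bs none a j)) (hN.indepFun_dl_bs none)
      (hB (measurableSet_singleton 0).compl) ?_
    filter_upwards [hN.ae_dlChannel_ne_zero hNT none] with ω hω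
    have h := hasLaw_sum_complexNormal (P := P)
      (X := fun (j : Fin NT) ω' => N.chan (.bs none i j) ω')
      (fun j => hN.law_chan (.bs none i j))
      (hN.indep_chan.precomp (g := fun j : Fin NT => ChannelEntry.bs none i j)
        (fun p q h => by simpa using h))
      (mrt (fun j => N.chan (.dl none j) ω))
    simp only [ChannelEntry.var, ← Finset.sum_mul, sum_nnnorm_mrt_sq hω, one_mul] at h
    simp_rw [beamformed_apply]
    rw [h.ae_iff (p := fun z => z ≠ 0) (measurableSet_singleton (0 : ℂ)).compl.mem, ae_iff]
    simp only [not_not]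
    refine complexNormal_singleton _ (Real.toNNReal_pos.2 ?_).ne' 0
    positivity
  filter_upwards [h] with ω hω h0
  refine hω ?_
  rw [← effChannel_eq, h0]
  rfl

/-- The law of the squared norm of the projected desired channel. -/
def signalLaw (i : Fin NR) : Measure ℝ :=
  (stdComplexNormal NR).map (fun z => ∑ j ∈ Finset.univ.erase i, ‖z j‖ ^ 2)

instance (i : Fin NR) : IsProbabilityMeasure (signalLaw i) :=
  Measure.isProbabilityMeasure_map (by fun_prop)

/-- Condition on the nulled direction: by unitary invariance every nonzero direction gives the same
projected law. -/
lemma IsModel.hasLaw_ulPower_none (hN : N.IsModel P lam K Att m) (hNT : 1 ≤ NT) (hK : 0 ≤ K)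
    (hAtt : 0 < Att) (i : Fin NR) : HasLaw (N.ulPower none) (signalLaw i) P := by
  have h := (indepFun_and_hasLaw_of_forall_map_eq (ν := signalLaw i)
    (F := fun q h => ‖((Submodule.span ℂ {q})ᗮ).starProjection h‖ ^ 2)
    (hN.measurable_effChannel none) (hN.measurable_ulChannel none)
    (hN.indepFun_effChannel_ulChannel none)
    ((measurable_starProjection_orthogonal_singleton measurable_fst
      measurable_snd).norm.pow_const 2) ?_).2
  · simpa only [← ulPower_none] using h
  · filter_upwards [hN.ae_effChannel_none_ne_zero i.pos hNT hK hAtt] with ω hω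
    rw [signalLaw, ← map_norm_sq_starProjection_stdComplexNormal hω i,
      ← (hN.hasLaw_ulChannel none).map_eq,
      Measure.map_map (by fun_prop) (hN.measurable_ulChannel _)]
    rfl

lemma IsModel.measure_ulPower_none_gt (hN : N.IsModel P lam K Att m) (hNR : 1 ≤ NR) (hNT : 1 ≤ NT)
    (hK : 0 ≤ K) (hAtt : 0 < Att) {t : ℝ} (ht : 0 ≤ t) :
    P {ω | t < N.ulPower none ω} = ENNReal.ofReal (erlangTail (NR - 1) t) := by
  have h := map_sum_norm_sq_stdComplexNormal_Ioi
    (Finset.univ.erase (⟨0, hNR⟩ : Fin NR)) ht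
  rw [Finset.card_erase_of_mem (Finset.mem_univ _), Finset.card_univ, Fintype.card_fin] at h
  rw [← h]
  exact (hN.hasLaw_ulPower_none hNT hK hAtt ⟨0, hNR⟩).measure_eq (p := fun x => t < x)
    measurableSet_Ioi

/-- The combiner is a unit vector unless the projection vanishes. As `NR - 1 ≥ 1`, the Erlang tail
at zero is one, so the projection is almost surely nonzero. -/
lemma IsModel.ae_norm_combiner (hN : N.IsModel P lam K Att m) (hNR : 2 ≤ NR) (hNT : 1 ≤ NT)
    (hK : 0 ≤ K) (hAtt : 0 < Att) : ∀ᵐ ω ∂P, ‖N.combiner ω‖ = 1 := by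
  have h := hN.measure_ulPower_none_gt (by omega) hNT hK hAtt le_rfl
  have h1 : erlangTail (NR - 1) 0 = 1 := by
    obtain ⟨k, rfl⟩ : ∃ k, NR = k + 2 := ⟨NR - 2, by omega⟩
    simp [erlangTail, Finset.sum_range_succ']
  rw [h1, ENNReal.ofReal_one] at h
  have h2 : ∀ᵐ ω ∂P, 0 < N.ulPower none ω := by
    have hm : Measurable (N.ulPower none) := by
      simp_rw [funext fun ω => N.ulPower_none ω]
      exact (measurable_starProjection_orthogonal_singleton
        (hN.measurable_effChannel none) (hN.measurable_ulChannel none)).norm.pow_const 2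
    exact (mem_ae_iff_prob_eq_one (measurableSet_lt measurable_const hm)).2 h
  filter_upwards [h2] with ω hω
  rw [ulPower_none] at hω
  exact norm_partialZeroForcing_const hω

attribute [local irreducible] gains combinerFun

/-- The joint law of the positions, directions and gains, and their independence of the desired
signal. -/
theorem IsModel.indepFun_and_hasLaw_gain (hN : N.IsModel P lam K Att m) (hNR : 2 ≤ NR)
    (hNT : 1 ≤ NT) (hK : 0 ≤ K) (hAtt : 0 < Att) :
    IndepFun (N.ulPower none)
      (fun ω => ((fun i => N.site i ω), (fun i => N.angle i ω), N.gain ω)) P ∧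
    HasLaw (fun ω => ((fun i => N.site i ω), (fun i => N.angle i ω), N.gain ω))
      ((P.map fun ω i => N.site i ω).prod
        ((Measure.infinitePi fun _ => cond (volume : Measure ℝ) (Icc 0 (2 * Real.pi))).prod
          (Measure.infinitePi fun _ => complexNormal 0 1))) P := by
  simp_rw [funext fun ω => N.ulPower_none_eq ω, gain_eq]
  have hs : Measurable fun ω i => N.site i ω :=
    measurable_pi_lambda _ fun i => hN.sites.measurable_point i
  have ha : Measurable fun ω i => N.angle i ω :=
    measurable_pi_lambda _ fun i => hN.measurable_angle i
  have hx := hN.measurable_ownChan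
  have hy := hN.measurable_otherChan
  have hpa : IsProbabilityMeasure (cond (volume : Measure ℝ) (Icc 0 (2 * Real.pi))) :=
    cond_isProbabilityMeasure_of_finite (by simp [Real.pi_pos])
      (by simp [ENNReal.mul_eq_top])
  have hla : HasLaw (fun ω i => N.angle i ω)
      (Measure.infinitePi fun _ => cond (volume : Measure ℝ) (Icc 0 (2 * Real.pi))) P :=
    hN.indep_angle.hasLaw_infinitePi hN.law_angle ha.aemeasurable
  have hps : IsProbabilityMeasure (P.map fun ω i => N.site i ω) :=
    Measure.isProbabilityMeasure_map hs.aemeasurable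
  have hxy : IndepFun N.ownChan N.otherChan P :=
    indepFun_of_disjoint hN.measurable_chan hN.indep_chan
      (fun c : {c : ChannelEntry NR NT // c.station = none} => (c : ChannelEntry NR NT))
      (fun c : {c : ChannelEntry NR NT // c.station ≠ none} => (c : ChannelEntry NR NT))
      (fun c d h => d.2 (h ▸ c.2))
  have haxy : IndepFun (fun ω i => N.angle i ω) (fun ω => (N.ownChan ω, N.otherChan ω)) P :=
    hN.indep_angle_chan.comp (φ := id) 
      (ψ := fun f : ChannelEntry NR NT → ℂ =>
        (((fun c => f c.1), (fun c => f c.1)) :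
          ({c : ChannelEntry NR NT // c.station = none} → ℂ) ×
            ({c : ChannelEntry NR NT // c.station ≠ none} → ℂ)))
      measurable_id (by fun_prop)
  have hsm : IndepFun (fun ω i => N.site i ω)
      (fun ω => (N.ownChan ω, (fun i => N.angle i ω), N.otherChan ω)) P :=
    hN.indep_site_marks.comp (φ := id)
      (ψ := fun f : (ℕ → ℝ) × (ChannelEntry NR NT → ℂ) =>
        (((fun c => f.2 c.1), f.1, (fun c => f.2 c.1)) :
          ({c : ChannelEntry NR NT // c.station = none} → ℂ) × (ℕ → ℝ) ×
            ({c : ChannelEntry NR NT // c.station ≠ none} → ℂ))) measurable_id (by fun_prop)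
  -- The own coefficients are first separated from directions and other coefficients, then from the
  -- positions as well.
  have hind := indepFun_left_comm hs hx (ha.prodMk hy) hsm (indepFun_left_comm ha hx hy haxy hxy)
  have hF : Measurable fun q : ({c : ChannelEntry NR NT // c.station = none} → ℂ) ×
      (ℕ → Plane) × (ℕ → ℝ) × ({c : ChannelEntry NR NT // c.station ≠ none} → ℂ) =>
      (q.2.1, q.2.2.1, gains (combinerFun q.1) q.2.2.2) :=
    Measurable.prodMk (by fun_prop) (Measurable.prodMk (by fun_prop)
      (measurable_gains (measurable_combinerFun.comp measurable_fst) (by fun_prop)))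
  have key := indepFun_and_hasLaw_of_forall_map_eq (P := P)
    (ν := (P.map fun ω i => N.site i ω).prod
        ((Measure.infinitePi fun _ => cond (volume : Measure ℝ) (Icc 0 (2 * Real.pi))).prod
          (Measure.infinitePi fun _ => complexNormal 0 1)))
    (F := fun x (p : (ℕ → Plane) × (ℕ → ℝ) × _) => (p.1, p.2.1, gains (combinerFun x) p.2.2))
    hx (hs.prodMk (ha.prodMk hy)) hind hF ?_
  · refine ⟨?_, key.2⟩
    have h2 : Measurable fun x : {c : ChannelEntry NR NT // c.station = none} → ℂ =>
        (WithLp.toLp 2 fun i => x ⟨.ul none i, rfl⟩ : EuclideanSpace ℂ (Fin NR)) := by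
      fun_prop
    exact key.1.comp (ψ := id) ((measurable_combinerFun.inner h2).norm.pow_const 2) measurable_id
  -- With the own coefficients frozen, the combiner is a fixed unit vector, and only its norm enters
  -- the law of the gains.
  · filter_upwards [hN.ae_norm_combiner hNR hNT hK hAtt] with ω hω
    rw [combiner_eq] at hω
    have hg : Measurable fun ω' => gains (combinerFun (N.ownChan ω)) (N.otherChan ω') :=
      measurable_gains measurable_const hy
    have h1 : IndepFun (fun ω i => N.angle i ω)
        (fun ω' => gains (combinerFun (N.ownChan ω)) (N.otherChan ω')) P :=
      haxy.comp (φ := id) 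
        (ψ := fun p : ({c : ChannelEntry NR NT // c.station = none} → ℂ) ×
          ({c : ChannelEntry NR NT // c.station ≠ none} → ℂ) =>
            gains (combinerFun (N.ownChan ω)) p.2) measurable_id
        (measurable_gains measurable_const measurable_snd)
    have h2 : IndepFun (fun ω i => N.site i ω) (fun ω' => ((fun i => N.angle i ω'),
        gains (combinerFun (N.ownChan ω)) (N.otherChan ω'))) P :=
      hsm.comp (φ := id) 
        (ψ := fun p : ({c : ChannelEntry NR NT // c.station = none} → ℂ) × (ℕ → ℝ) ×
          ({c : ChannelEntry NR NT // c.station ≠ none} → ℂ) =>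
            (p.2.1, gains (combinerFun (N.ownChan ω)) p.2.2))
        measurable_id (measurable_snd.fst.prodMk
          (measurable_gains measurable_const measurable_snd.snd))
    rw [(indepFun_iff_map_prod_eq_prod_map_map hs.aemeasurable (ha.prodMk hg).aemeasurable).1 h2,
      (indepFun_iff_map_prod_eq_prod_map_map ha.aemeasurable hg.aemeasurable).1 h1, hla.map_eq,
      (hN.hasLaw_gains hNT hω).map_eq]

end Network

/-! ### The functions `Ψ` and `Υ` -/

/-- The squared distance from the origin of a point at distance `R` from a point with norm `r`. -/
def sqDist (R r φ : ℝ) : ℝ := r ^ 2 + R ^ 2 + 2 * r * R * Real.cos φ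

lemma sqDist_nonneg (R r φ : ℝ) : 0 ≤ sqDist R r φ := by
  have := Real.sin_sq_add_cos_sq φ
  have h : sqDist R r φ = (r + R * Real.cos φ) ^ 2 + (R * Real.sin φ) ^ 2 := by
    unfold sqDist
    linear_combination (-R ^ 2) * this
  rw [h]
  positivity

lemma le_sqDist {R r : ℝ} (hR : 0 ≤ R) (hr : 0 ≤ r) (φ : ℝ) : (r - R) ^ 2 ≤ sqDist R r φ := by
  have := mul_le_mul_of_nonneg_left (Real.neg_one_le_cos φ) (mul_nonneg hr hR)
  unfold sqDist
  nlinarith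

/-- The angular integrand of `Ψ`. -/
def psiIntegrand (α ρU R s r φ : ℝ) : ℝ := 1 / (1 + s * ρU * sqDist R r φ ^ (-(α / 2)))

lemma measurable_psiIntegrand (α ρU R s : ℝ) :
    Measurable fun p : ℝ × ℝ => psiIntegrand α ρU R s p.1 p.2 := by
  unfold psiIntegrand sqDist
  fun_prop

section Psi

variable {α ρB ρU R s r : ℝ}

lemma psiIntegrand_pos (hs : 0 ≤ s * ρU) (φ : ℝ) : 0 < psiIntegrand α ρU R s r φ := by
  have := Real.rpow_nonneg (sqDist_nonneg R r φ) (-(α / 2))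
  unfold psiIntegrand
  positivity

lemma psiIntegrand_le_one (hs : 0 ≤ s * ρU) (φ : ℝ) : psiIntegrand α ρU R s r φ ≤ 1 := by
  have := mul_nonneg hs (Real.rpow_nonneg (sqDist_nonneg R r φ) (-(α / 2)))
  unfold psiIntegrand
  rw [div_le_one (by linarith)]
  linarith

lemma intervalIntegrable_psiIntegrand (hs : 0 ≤ s * ρU) (a b : ℝ) :
    IntervalIntegrable (psiIntegrand α ρU R s r) volume a b := by
  refine (intervalIntegrable_const (c := (1 : ℝ))).mono_fun
    ((measurable_psiIntegrand α ρU R s).comp measurable_prodMk_left).aestronglyMeasurable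
    (.of_forall fun φ => ?_)
  beta_reduce
  rw [Real.norm_of_nonneg (psiIntegrand_pos hs φ).le, norm_one]
  exact psiIntegrand_le_one hs φ

lemma Psi_eq : Psi α ρU R s r =
    1 / (2 * Real.pi) * ∫ φ in (0 : ℝ)..(2 * Real.pi), psiIntegrand α ρU R s r φ := rfl

lemma le_Psi (hs : 0 ≤ s * ρU) {c : ℝ} (hc : ∀ φ, c ≤ psiIntegrand α ρU R s r φ) :
    c ≤ Psi α ρU R s r := by
  have h := intervalIntegral.integral_mono_on (μ := volume) Real.two_pi_pos.le
    (intervalIntegrable_const (c := c)) (intervalIntegrable_psiIntegrand (α := α) (R := R)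
      (r := r) hs 0 (2 * Real.pi)) (fun φ _ => hc φ)
  rw [intervalIntegral.integral_const, smul_eq_mul, sub_zero] at h
  rw [Psi_eq, one_div, ← div_eq_inv_mul, le_div_iff₀ Real.two_pi_pos]
  linarith

lemma Psi_le_one (hs : 0 ≤ s * ρU) : Psi α ρU R s r ≤ 1 := by
  have h := intervalIntegral.integral_mono_on (μ := volume) Real.two_pi_pos.le
    (intervalIntegrable_psiIntegrand (α := α) (R := R) (r := r) hs 0 (2 * Real.pi))
    (intervalIntegrable_const (c := (1 : ℝ))) (fun φ _ => psiIntegrand_le_one hs φ)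
  rw [intervalIntegral.integral_const, smul_eq_mul, sub_zero, mul_one] at h
  rw [Psi_eq, one_div, ← div_eq_inv_mul, div_le_one Real.two_pi_pos]
  exact h

lemma Psi_pos (hs : 0 ≤ s * ρU) : 0 < Psi α ρU R s r := by
  rw [Psi_eq]
  exact mul_pos (by positivity) (intervalIntegral.intervalIntegral_pos_of_pos
    (intervalIntegrable_psiIntegrand hs _ _) (psiIntegrand_pos hs) Real.two_pi_pos)

lemma measurable_Psi : Measurable (Psi α ρU R s) := by
  have h : Psi α ρU R s = fun r => 1 / (2 * Real.pi) *
      ∫ φ in Ioc (0 : ℝ) (2 * Real.pi), psiIntegrand α ρU R s r φ := by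
    ext r
    rw [Psi_eq, intervalIntegral.integral_of_le Real.two_pi_pos.le]
  rw [h]
  exact ((measurable_psiIntegrand α ρU R s).stronglyMeasurable.integral_prod_right'
    (ν := volume.restrict (Ioc (0 : ℝ) (2 * Real.pi)))).measurable.const_mul _

/-- The conditional Laplace transform of the interference from a cell at distance `r`. -/
def cellTransform (α ρB ρU R s r : ℝ) : ℝ := 1 / (1 + s * ρB * r ^ (-α)) * Psi α ρU R s r

lemma measurable_cellTransform : Measurable (cellTransform α ρB ρU R s) := by
  unfold cellTransform
  exact Measurable.mul (by fun_prop) measurable_Psi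

lemma one_add_rpow_pos (hB : 0 ≤ s * ρB) (hr : 0 ≤ r) : 0 < 1 + s * ρB * r ^ (-α) := by
  have := mul_nonneg hB (Real.rpow_nonneg hr (-α))
  linarith

lemma cellTransform_pos (hB : 0 ≤ s * ρB) (hU : 0 ≤ s * ρU) (hr : 0 ≤ r) :
    0 < cellTransform α ρB ρU R s r :=
  mul_pos (one_div_pos.2 (one_add_rpow_pos hB hr)) (Psi_pos hU)

lemma cellTransform_le_one (hB : 0 ≤ s * ρB) (hU : 0 ≤ s * ρU) (hr : 0 ≤ r) :
    cellTransform α ρB ρU R s r ≤ 1 := by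
  refine mul_le_one₀ ?_ (Psi_pos hU).le (Psi_le_one hU)
  rw [div_le_one (one_add_rpow_pos hB hr)]
  linarith [mul_nonneg hB (Real.rpow_nonneg hr (-α))]

/-- When `r ≥ 2R` the uplink node is at distance at least `r - R ≥ r / 2`, which explains the factor
`2 ^ α`. The rest is `1 - 1 / ((1 + a)(1 + b)) ≤ a + b`. -/
lemma one_sub_cellTransform_le (hα : 0 ≤ α) (hB : 0 ≤ s * ρB) (hU : 0 ≤ s * ρU) (hR : 0 < R)
    (hr : 2 * R ≤ r) :
    1 - cellTransform α ρB ρU R s r ≤ s * (ρB + ρU * 2 ^ α) * r ^ (-α) := by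
  have hr0 : 0 < r := by linarith
  set a := s * ρB * r ^ (-α)
  set b := s * ρU * (2 ^ α * r ^ (-α))
  have ha : 0 ≤ a := mul_nonneg hB (Real.rpow_nonneg hr0.le _)
  have hb : 0 ≤ b := mul_nonneg hU (by positivity)
  have hpsi : 1 / (1 + b) ≤ Psi α ρU R s r := by
    refine le_Psi hU fun φ => ?_
    have h1 : (r / 2) ^ 2 ≤ sqDist R r φ :=
      (by nlinarith : (r / 2) ^ 2 ≤ (r - R) ^ 2).trans (le_sqDist hR.le hr0.le φ)
    have h2 : sqDist R r φ ^ (-(α / 2)) ≤ 2 ^ α * r ^ (-α) := by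
      refine (Real.rpow_le_rpow_of_nonpos (by positivity) h1 (by linarith)).trans_eq ?_
      rw [← Real.rpow_natCast, ← Real.rpow_mul (by positivity)]
      have : ((2 : ℕ) : ℝ) * (-(α / 2)) = -α := by push_cast; ring
      rw [this, Real.div_rpow hr0.le (by norm_num), Real.rpow_neg (by norm_num : (0 : ℝ) ≤ 2)]
      field_simp
    unfold psiIntegrand
    refine one_div_le_one_div_of_le ?_ ?_
    · linarith [mul_nonneg hU (Real.rpow_nonneg (sqDist_nonneg R r φ) (-(α / 2)))]
    · linarith [mul_le_mul_of_nonneg_left h2 hU]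
  have h3 : 1 / (1 + a) * (1 / (1 + b)) ≤ cellTransform α ρB ρU R s r :=
    mul_le_mul_of_nonneg_left hpsi (by positivity)
  have h4 : 1 - 1 / (1 + a) * (1 / (1 + b)) ≤ a + b := by
    rw [one_div_mul_one_div, sub_le_iff_le_add, ← sub_le_iff_le_add', le_div_iff₀ (by positivity)]
    nlinarith [mul_nonneg ha hb, mul_nonneg ha ha, mul_nonneg hb hb,
      mul_nonneg (mul_nonneg ha hb) ha, mul_nonneg (mul_nonneg ha hb) hb]
  calc _ ≤ a + b := by linarith
    _ = _ := by simp only [a, b]; ring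

lemma upsilonIntegrand_eq : upsilonIntegrand α ρB ρU R s r =
    (1 - cellTransform α ρB ρU R s r) * r := rfl

/-- An integrable function that dominates the radial integrands of `Υ(t)` for `t ≤ s`. -/
def upsilonBound (α ρB ρU R s r : ℝ) : ℝ :=
  (Ioc 0 (2 * R)).indicator (fun r => r) r +
    (Ioi (2 * R)).indicator (fun r => s * (ρB + ρU * 2 ^ α) * r ^ (1 - α)) r

lemma integrable_upsilonBound (hα : 2 < α) (hR : 0 < R) :
    Integrable (upsilonBound α ρB ρU R s) := by
  refine Integrable.add ?_ ?_
  · rw [integrable_indicator_iff measurableSet_Ioc]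
    exact (continuous_id.integrableOn_Icc).mono_set Ioc_subset_Icc_self
  · rw [integrable_indicator_iff measurableSet_Ioi]
    exact (integrableOn_Ioi_rpow_of_lt (by linarith) (by linarith)).const_mul _

/-- Near the origin the transform lies in `[0, 1]`, so the integrand is at most `r`; beyond `2R` the
decay estimate gives `r^{1-α}`. Uniformity in `t ≤ s` allows dominated convergence as `t → 0`. -/
lemma norm_upsilonIntegrand_le {t : ℝ} (hα : 2 < α) (hB : 0 ≤ ρB) (hU : 0 ≤ ρU) (hR : 0 < R)
    (ht : 0 ≤ t) (hts : t ≤ s) (hr : 0 < r) :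
    ‖upsilonIntegrand α ρB ρU R t r‖ ≤ upsilonBound α ρB ρU R s r := by
  have hB' := mul_nonneg ht hB
  have hU' := mul_nonneg ht hU
  have h1 := (cellTransform_pos (α := α) (R := R) hB' hU' hr.le).le
  have h2 := cellTransform_le_one (α := α) (R := R) hB' hU' hr.le
  rw [upsilonIntegrand_eq, Real.norm_of_nonneg (mul_nonneg (by linarith) hr.le), upsilonBound]
  by_cases hr2 : r ≤ 2 * R
  · rw [indicator_of_mem (show r ∈ Ioc 0 (2 * R) from ⟨hr, hr2⟩),
      indicator_of_notMem (by simpa using hr2), add_zero]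
    nlinarith
  · rw [not_le] at hr2
    rw [indicator_of_notMem (fun h => not_lt.2 h.2 hr2),
      indicator_of_mem (show r ∈ Ioi (2 * R) from hr2), zero_add]
    have h3 := one_sub_cellTransform_le (α := α) (by linarith) hB' hU' hR hr2.le
    calc _ ≤ t * (ρB + ρU * 2 ^ α) * r ^ (-α) * r := mul_le_mul_of_nonneg_right h3 hr.le
      _ = t * (ρB + ρU * 2 ^ α) * r ^ (1 - α) := by
        rw [mul_assoc, sub_eq_neg_add, Real.rpow_add_one hr.ne']
      _ ≤ _ := by gcongr

lemma integrableOn_upsilonIntegrand (hα : 2 < α) (hB : 0 ≤ ρB) (hU : 0 ≤ ρU) (hR : 0 < R)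
    (hs : 0 ≤ s) : IntegrableOn (upsilonIntegrand α ρB ρU R s) (Ioi 0) := by
  refine (integrable_upsilonBound (ρB := ρB) (ρU := ρU) (s := s) hα hR).integrableOn.mono' ?_ ?_
  · exact ((measurable_const.sub measurable_cellTransform).mul measurable_id).aestronglyMeasurable
  · exact (ae_restrict_iff' measurableSet_Ioi).2 (.of_forall fun r hr =>
      norm_upsilonIntegrand_le hα hB hU hR hs le_rfl hr)

lemma tendsto_Psi_zero (hU : 0 ≤ ρU) {u : ℕ → ℝ} (hu : ∀ n, 0 ≤ u n)
    (hlim : Filter.Tendsto u Filter.atTop (nhds 0)) :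
    Filter.Tendsto (fun n => Psi α ρU R (u n) r) Filter.atTop (nhds 1) := by
  have h : Filter.Tendsto (fun n => ∫ φ in (0 : ℝ)..(2 * Real.pi), psiIntegrand α ρU R (u n) r φ)
      Filter.atTop (nhds (∫ _ in (0 : ℝ)..(2 * Real.pi), (1 : ℝ))) := by
    refine intervalIntegral.tendsto_integral_filter_of_dominated_convergence (fun _ => 1)
      (.of_forall fun n => ((measurable_psiIntegrand α ρU R (u n)).comp
        measurable_prodMk_left).aestronglyMeasurable)
      (.of_forall fun n => .of_forall fun φ _ => ?_) intervalIntegrable_const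
      (.of_forall fun φ _ => ?_)
    · rw [Real.norm_of_nonneg (psiIntegrand_pos (mul_nonneg (hu n) hU) φ).le]
      exact psiIntegrand_le_one (mul_nonneg (hu n) hU) φ
    · have h1 : Filter.Tendsto (fun n => 1 + u n * ρU * sqDist R r φ ^ (-(α / 2)))
          Filter.atTop (nhds (1 + 0 * ρU * sqDist R r φ ^ (-(α / 2)))) :=
        ((hlim.mul_const _).mul_const _).const_add _
      have h2 := (tendsto_const_nhds (x := (1 : ℝ))).div h1 (by simp)
      rw [zero_mul, zero_mul, add_zero, div_one] at h2
      exact h2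
  have h2 := h.const_mul (1 / (2 * Real.pi))
  have h3 : 1 / (2 * Real.pi) * ∫ _ in (0 : ℝ)..(2 * Real.pi), (1 : ℝ) = 1 := by
    have := Real.pi_ne_zero
    simp
    field_simp
  rw [h3] at h2
  exact h2

lemma tendsto_Upsilon_zero (hα : 2 < α) (hB : 0 ≤ ρB) (hU : 0 ≤ ρU) (hR : 0 < R) {u : ℕ → ℝ}
    (hu : ∀ n, 0 ≤ u n) (hu1 : ∀ n, u n ≤ 1) (hlim : Filter.Tendsto u Filter.atTop (nhds 0)) :
    Filter.Tendsto (fun n => Upsilon α ρB ρU R (u n)) Filter.atTop (nhds 0) := by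
  have h : Filter.Tendsto (fun n => ∫ r in Ioi (0 : ℝ), upsilonIntegrand α ρB ρU R (u n) r)
      Filter.atTop (nhds (∫ _ in Ioi (0 : ℝ), (0 : ℝ))) := by
    refine tendsto_integral_of_dominated_convergence (upsilonBound α ρB ρU R 1)
      (fun n => (integrableOn_upsilonIntegrand hα hB hU hR (hu n)).aestronglyMeasurable)
      (integrable_upsilonBound hα hR).integrableOn (fun n =>
        (ae_restrict_iff' measurableSet_Ioi).2 (.of_forall fun r hr =>
          norm_upsilonIntegrand_le hα hB hU hR (hu n) (hu1 n) hr))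
      (.of_forall fun r => ?_)
    have h1 : Filter.Tendsto (fun n => 1 + u n * ρB * r ^ (-α))
        Filter.atTop (nhds (1 + 0 * ρB * r ^ (-α))) :=
      ((hlim.mul_const _).mul_const _).const_add _
    have h2 := (tendsto_const_nhds (x := (1 : ℝ))).div h1 (by simp)
    have h3 := ((h2.mul (tendsto_Psi_zero (α := α) (R := R) (r := r) hU hu hlim)).const_sub
      1).mul_const r
    rw [zero_mul, zero_mul, add_zero, div_one, one_mul, sub_self, zero_mul] at h3
    exact h3
  have h2 := h.const_mul (2 * Real.pi)
  simpa [Upsilon] using h2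

lemma integrable_one_sub_cellTransform (hα : 2 < α) (hB : 0 ≤ ρB) (hU : 0 ≤ ρU) (hR : 0 < R)
    (hs : 0 ≤ s) : Integrable fun x : Plane => 1 - cellTransform α ρB ρU R s ‖x‖ := by
  rw [integrable_fun_norm_addHaar volume (f := fun r => 1 - cellTransform α ρB ρU R s r)]
  refine (integrableOn_upsilonIntegrand (α := α) hα hB hU hR hs).congr_fun (fun r _ => ?_)
    measurableSet_Ioi
  simp [upsilonIntegrand_eq, mul_comm]

/-- Polar coordinates; the constant `2π` is the dimension times the area of the unit disc. -/
lemma integral_one_sub_cellTransform :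
    ∫ x : Plane, (1 - cellTransform α ρB ρU R s ‖x‖) = Upsilon α ρB ρU R s := by
  rw [integral_fun_norm_addHaar volume (fun r => 1 - cellTransform α ρB ρU R s r), Upsilon]
  have h : (volume : Measure Plane).real (Metric.ball 0 1) = Real.pi := by
    rw [Measure.real, EuclideanSpace.volume_ball_fin_two]
    simp [Real.pi_pos.le]
  rw [h]
  simp only [finrank_euclideanSpace_fin, nsmul_eq_mul, smul_eq_mul, mul_assoc]
  norm_num
  refine setIntegral_congr_fun measurableSet_Ioi fun r _ => ?_
  rw [upsilonIntegrand_eq, mul_comm]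

lemma lintegral_one_sub_cellTransform (hα : 2 < α) (hB : 0 ≤ ρB) (hU : 0 ≤ ρU) (hR : 0 < R)
    (hs : 0 ≤ s) : ∫⁻ x : Plane, (1 - ENNReal.ofReal (cellTransform α ρB ρU R s ‖x‖)) =
      ENNReal.ofReal (Upsilon α ρB ρU R s) := by
  rw [← integral_one_sub_cellTransform, ofReal_integral_eq_lintegral_ofReal
    (integrable_one_sub_cellTransform hα hB hU hR hs)]
  · refine lintegral_congr fun x => ?_
    rw [ENNReal.ofReal_sub _
      (cellTransform_pos (mul_nonneg hs hB) (mul_nonneg hs hU) (norm_nonneg x)).le,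
      ENNReal.ofReal_one]
  · exact .of_forall fun x => sub_nonneg.2
      (cellTransform_le_one (mul_nonneg hs hB) (mul_nonneg hs hU) (norm_nonneg x))

lemma Upsilon_nonneg (hB : 0 ≤ ρB) (hU : 0 ≤ ρU) (hs : 0 ≤ s) : 0 ≤ Upsilon α ρB ρU R s := by
  rw [← integral_one_sub_cellTransform]
  exact integral_nonneg fun x => sub_nonneg.2
      (cellTransform_le_one (mul_nonneg hs hB) (mul_nonneg hs hU) (norm_nonneg x))

/-- The law of cosines, with `t` the polar angle of `x`, read off as a complex argument. At `x = 0`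
the angle is irrelevant. -/
lemma norm_add_smul_rpow (x : Plane) (R α : ℝ) : ∃ t : ℝ, ∀ a : ℝ,
    ‖x + R • !₂[Real.cos a, Real.sin a]‖ ^ (-α) = sqDist R ‖x‖ (a - t) ^ (-(α / 2)) := by
  let c : ℂ := ⟨x 0, x 1⟩
  have hc : ‖x‖ = ‖c‖ := by
    rw [EuclideanSpace.norm_eq, Fin.sum_univ_two, Complex.norm_eq_sqrt_sq_add_sq]
    simp [c]
  have h0 : x 0 = ‖x‖ * Real.cos c.arg := by rw [hc, Complex.norm_mul_cos_arg]
  have h1 : x 1 = ‖x‖ * Real.sin c.arg := by rw [hc, Complex.norm_mul_sin_arg]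
  refine ⟨c.arg, fun a => ?_⟩
  have h2 : ‖x + R • !₂[Real.cos a, Real.sin a]‖ = √(sqDist R ‖x‖ (a - c.arg)) := by
    rw [EuclideanSpace.norm_eq, Fin.sum_univ_two]
    congr 1
    simp only [PiLp.add_apply, PiLp.smul_apply, smul_eq_mul, Real.norm_eq_abs, sq_abs]
    simp only [Matrix.cons_val_zero, Matrix.cons_val_one]
    have h3 : ‖x‖ ^ 2 = (x 0) ^ 2 + (x 1) ^ 2 := by
      rw [EuclideanSpace.norm_sq_eq, Fin.sum_univ_two]
      simp
    rw [sqDist, h3, Real.cos_sub]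
    linear_combination (2 * R * Real.cos a) * h0 + (2 * R * Real.sin a) * h1 +
      R ^ 2 * Real.sin_sq_add_cos_sq a
  rw [h2, Real.sqrt_eq_rpow, ← Real.rpow_mul (sqDist_nonneg _ _ _)]
  congr 1
  ring

/-- The polar angle of `x` only shifts the direction, and averaging over a full period absorbs the
shift. -/
lemma lintegral_angle (hU : 0 ≤ s * ρU) (x : Plane) :
    ∫⁻ a, ENNReal.ofReal (1 / (1 + s * ρU * ‖x + R • !₂[Real.cos a, Real.sin a]‖ ^ (-α)))
      ∂(cond (volume : Measure ℝ) (Icc 0 (2 * Real.pi))) = ENNReal.ofReal (Psi α ρU R s ‖x‖) := by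
  obtain ⟨t, ht⟩ := norm_add_smul_rpow x R α
  have h1 : ∫ a in (0 : ℝ)..(2 * Real.pi), psiIntegrand α ρU R s ‖x‖ (a - t) =
      ∫ a in (0 : ℝ)..(2 * Real.pi), psiIntegrand α ρU R s ‖x‖ a := by
    rw [intervalIntegral.integral_comp_sub_right (psiIntegrand α ρU R s ‖x‖)]
    have hper : Function.Periodic (psiIntegrand α ρU R s ‖x‖) (2 * Real.pi) := fun a => by
      simp [psiIntegrand, sqDist]
    have := hper.intervalIntegral_add_eq (0 - t) 0
    rw [zero_add] at this
    rw [← this]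
    congr 1
    ring
  have h2 : IntegrableOn (fun a => psiIntegrand α ρU R s ‖x‖ (a - t)) (Icc 0 (2 * Real.pi)) := by
    rw [integrableOn_Icc_iff_integrableOn_Ioc,
      ← intervalIntegrable_iff_integrableOn_Ioc_of_le Real.two_pi_pos.le]
    have := (intervalIntegrable_psiIntegrand (α := α) (R := R) (r := ‖x‖) hU (0 - t)
      (2 * Real.pi - t)).comp_sub_right t
    simpa using this
  simp_rw [ht]
  rw [ProbabilityTheory.cond, lintegral_smul_measure, Psi_eq,
    ENNReal.ofReal_mul (by positivity), ← h1, intervalIntegral.integral_of_le Real.two_pi_pos.le,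
    ← integral_Icc_eq_integral_Ioc,
    ofReal_integral_eq_lintegral_ofReal h2 (.of_forall fun a => (psiIntegrand_pos hU _).le),
    Real.volume_Icc, sub_zero, one_div, ENNReal.ofReal_inv_of_pos Real.two_pi_pos]
  rfl

end Psi

/-! ### The Laplace transform of the interference -/

/-- Lets independence be used for finitely many cells only, before passing to the whole series. -/
lemma tendsto_lintegral_prod_expNeg {Ω : Type*} [MeasurableSpace Ω] {P : Measure Ω}
    [IsFiniteMeasure P] {u : ℕ → Ω → ℝ≥0∞} (hu : ∀ i, Measurable (u i)) :
    Filter.Tendsto (fun n => ∫⁻ ω, ∏ i ∈ Finset.range n, expNeg (u i ω) ∂P) Filter.atTop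
      (nhds (∫⁻ ω, expNeg (∑' i, u i ω) ∂P)) := by
  simp_rw [← expNeg_sum]
  refine tendsto_lintegral_of_dominated_convergence (fun _ => 1) (fun n => ?_)
    (fun n => .of_forall fun ω => expNeg_le_one _) (by simp) (.of_forall fun ω => ?_)
  · exact measurable_expNeg.comp (Finset.measurable_fun_sum _ fun i _ => hu i)
  · exact (continuous_expNeg.tendsto _).comp ENNReal.summable.hasSum.tendsto_sum_nat

/-- The interference from a base station at `x` whose uplink node lies in direction `a`, with
gains `z` and `z'`. -/
def cellTerm (α ρB ρU R : ℝ) (x : Plane) (a : ℝ) (z z' : ℂ) : ℝ :=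
  ρB * ‖x‖ ^ (-α) * ‖z‖ ^ 2 + ρU * ‖x + R • !₂[Real.cos a, Real.sin a]‖ ^ (-α) * ‖z'‖ ^ 2

lemma measurable_cellTerm (α ρB ρU R : ℝ) : Measurable fun p : Plane × ℝ × ℂ × ℂ =>
    cellTerm α ρB ρU R p.1 p.2.1 p.2.2.1 p.2.2.2 := by
  have h : Measurable fun p : Plane × ℝ × ℂ × ℂ =>
      p.1 + R • (!₂[Real.cos p.2.1, Real.sin p.2.1] : Plane) := by
    refine measurable_fst.add (Measurable.const_smul ((WithLp.measurable_toLp 2 _).comp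
      (measurable_pi_lambda _ fun i => ?_)) R)
    fin_cases i
    · exact Real.measurable_cos.comp (by fun_prop)
    · exact Real.measurable_sin.comp (by fun_prop)
  unfold cellTerm
  fun_prop

lemma lintegral_prod_expNeg_norm_sq {c : ℕ ⊕ ℕ → ℝ} (hc : ∀ k, 0 ≤ c k) (n : ℕ) :
    ∫⁻ z : ℕ ⊕ ℕ → ℂ, ∏ i ∈ Finset.range n, expNeg (ENNReal.ofReal
        (c (.inl i) * ‖z (.inl i)‖ ^ 2 + c (.inr i) * ‖z (.inr i)‖ ^ 2))
      ∂(Measure.infinitePi fun _ => complexNormal 0 1) =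
    ∏ i ∈ Finset.range n, ENNReal.ofReal (1 / (1 + c (.inl i))) *
      ENNReal.ofReal (1 / (1 + c (.inr i))) := by
  have hm : ∀ k, Measurable fun w : ℂ => expNeg (ENNReal.ofReal (c k * ‖w‖ ^ 2)) := fun k =>
    measurable_expNeg.comp (by fun_prop)
  have h := lintegral_prod_eq_prod_lintegral_of_indepFun
    ((Finset.range n).disjSum (Finset.range n))
    (fun (k : ℕ ⊕ ℕ) (z : ℕ ⊕ ℕ → ℂ) => expNeg (ENNReal.ofReal (c k * ‖z k‖ ^ 2)))
    (iIndepFun_infinitePi (P := fun _ : ℕ ⊕ ℕ => complexNormal 0 1)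
      (X := fun k w => expNeg (ENNReal.ofReal (c k * ‖w‖ ^ 2))) hm)
    (fun k => (hm k).comp (measurable_pi_apply k))
  have h1 : ∀ k, ∫⁻ z : ℕ ⊕ ℕ → ℂ, expNeg (ENNReal.ofReal (c k * ‖z k‖ ^ 2))
      ∂(Measure.infinitePi fun _ => complexNormal 0 1) = ENNReal.ofReal (1 / (1 + c k)) := by
    intro k
    rw [← lintegral_expNeg_norm_sq_complexNormal (hc k)]
    conv_rhs => rw [← Measure.infinitePi_map_eval (fun _ : ℕ ⊕ ℕ => complexNormal 0 1) k]
    rw [lintegral_map (hm k) (measurable_pi_apply k)]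
  simp only [h1, Finset.prod_disjSum, ← Finset.prod_mul_distrib] at h
  rw [← h]
  refine lintegral_congr fun z => Finset.prod_congr rfl fun i _ => ?_
  rw [← expNeg_add, ENNReal.ofReal_add (mul_nonneg (hc _) (by positivity))
    (mul_nonneg (hc _) (by positivity))]

namespace Network

variable {NR NT : ℕ} {Ω : Type*} {α ρB ρU R lam K Att : ℝ}

lemma cellInterference_eq (N : Network NR NT Ω) (i : ℕ) (ω : Ω) :
    N.cellInterference α ρB ρU R i ω =
      cellTerm α ρB ρU R (N.site i ω) (N.angle i ω) (N.gain ω (.inl i)) (N.gain ω (.inr i)) := rfl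

lemma cellInterference_nonneg (N : Network NR NT Ω) (hB : 0 ≤ ρB) (hU : 0 ≤ ρU) (i : ℕ) (ω : Ω) :
    0 ≤ N.cellInterference α ρB ρU R i ω := by
  rw [cellInterference_eq, cellTerm]
  positivity

variable [MeasurableSpace Ω] {P : Measure Ω} {N : Network NR NT Ω} {m : Fin NR → Fin NT → ℂ}

lemma IsModel.measurable_gain (hN : N.IsModel P lam K Att m) : Measurable N.gain := by
  simp_rw [funext fun ω => N.gain_eq ω]
  exact measurable_gains (measurable_combinerFun.comp hN.measurable_ownChan)
    hN.measurable_otherChan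

lemma IsModel.measurable_cellInterference (hN : N.IsModel P lam K Att m) (i : ℕ) :
    Measurable (N.cellInterference α ρB ρU R i) := by
  simp_rw [funext fun ω => N.cellInterference_eq (α := α) (ρB := ρB) (ρU := ρU) (R := R) i ω]
  exact (measurable_cellTerm α ρB ρU R).comp (f := fun ω =>
    (N.site i ω, N.angle i ω, N.gain ω (.inl i), N.gain ω (.inr i)))
    ((hN.sites.measurable_point i).prodMk ((hN.measurable_angle i).prodMk
      (((measurable_pi_apply _).comp hN.measurable_gain).prodMk
        ((measurable_pi_apply _).comp hN.measurable_gain))))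

variable [IsProbabilityMeasure P]

/-- Under the product law, integrate out the gains, giving factors `1 / (1 + c)`, and then the
directions, giving `Psi`. The positions stay random. -/
lemma IsModel.lintegral_prod_cell (hN : N.IsModel P lam K Att m) (hNR : 2 ≤ NR)
    (hNT : 1 ≤ NT) (hK : 0 ≤ K) (hAtt : 0 < Att) (hB : 0 ≤ ρB) (hU : 0 ≤ ρU) {s : ℝ}
    (hs : 0 ≤ s) (n : ℕ) :
    ∫⁻ ω, ∏ i ∈ Finset.range n,
        expNeg (ENNReal.ofReal (s * N.cellInterference α ρB ρU R i ω)) ∂P =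
      ∫⁻ ω, ∏ i ∈ Finset.range n,
        ENNReal.ofReal (cellTransform α ρB ρU R s ‖N.site i ω‖) ∂P := by
  have hpa : IsProbabilityMeasure (cond (volume : Measure ℝ) (Icc 0 (2 * Real.pi))) :=
    cond_isProbabilityMeasure_of_finite (by simp [Real.pi_pos])
      (by simp [ENNReal.mul_eq_top])
  have hsm : Measurable fun ω i => N.site i ω :=
    measurable_pi_lambda _ fun i => hN.sites.measurable_point i
  have hsB := mul_nonneg hs hB
  have hsU := mul_nonneg hs hU
  let G : (ℕ → Plane) × (ℕ → ℝ) × (ℕ ⊕ ℕ → ℂ) → ℝ≥0∞ := fun p => ∏ i ∈ Finset.range n,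
    expNeg (ENNReal.ofReal (s * cellTerm α ρB ρU R (p.1 i) (p.2.1 i) (p.2.2 (.inl i))
      (p.2.2 (.inr i))))
  have hG : Measurable G := by
    refine Finset.measurable_fun_prod _ fun i _ => measurable_expNeg.comp
      (ENNReal.measurable_ofReal.comp (Measurable.const_mul ?_ s))
    exact (measurable_cellTerm α ρB ρU R).comp (f := fun p : (ℕ → Plane) × (ℕ → ℝ) ×
      (ℕ ⊕ ℕ → ℂ) => (p.1 i, p.2.1 i, p.2.2 (.inl i), p.2.2 (.inr i))) (by fun_prop)
  have h1 : ∫⁻ ω, ∏ i ∈ Finset.range n,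
        expNeg (ENNReal.ofReal (s * N.cellInterference α ρB ρU R i ω)) ∂P =
      ∫⁻ ω, G ((fun i => N.site i ω), (fun i => N.angle i ω), N.gain ω) ∂P := rfl
  rw [h1, (hN.indepFun_and_hasLaw_gain hNR hNT hK hAtt).2.lintegral_comp hG.aemeasurable,
    lintegral_prod _ hG.aemeasurable]
  have h2 : ∀ x : ℕ → Plane, ∫⁻ q, G (x, q)
      ∂((Measure.infinitePi fun _ => cond (volume : Measure ℝ) (Icc 0 (2 * Real.pi))).prod
        (Measure.infinitePi fun _ => complexNormal 0 1)) =
      ∏ i ∈ Finset.range n, ENNReal.ofReal (cellTransform α ρB ρU R s ‖x i‖) := by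
    intro x
    rw [lintegral_prod (fun q => G (x, q)) (hG.comp measurable_prodMk_left).aemeasurable]
    let c : (ℕ → ℝ) → ℕ ⊕ ℕ → ℝ := fun a => Sum.elim (fun i => s * ρB * ‖x i‖ ^ (-α))
      (fun i => s * ρU * ‖x i + R • !₂[Real.cos (a i), Real.sin (a i)]‖ ^ (-α))
    have hc : ∀ a k, 0 ≤ c a k := by
      rintro a (i | i)
      · exact mul_nonneg hsB (Real.rpow_nonneg (norm_nonneg _) _)
      · exact mul_nonneg hsU (Real.rpow_nonneg (norm_nonneg _) _)
    have h3 : ∀ a : ℕ → ℝ, ∫⁻ z, G (x, a, z) ∂(Measure.infinitePi fun _ => complexNormal 0 1) =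
        ∏ i ∈ Finset.range n, ENNReal.ofReal (1 / (1 + c a (.inl i))) *
          ENNReal.ofReal (1 / (1 + c a (.inr i))) := by
      intro a
      rw [← lintegral_prod_expNeg_norm_sq (hc a)]
      refine lintegral_congr fun z => Finset.prod_congr rfl fun i _ => ?_
      congr 2
      simp only [cellTerm, c, Sum.elim_inl, Sum.elim_inr]
      ring
    simp_rw [h3]
    let g : ℕ → ℝ → ℝ≥0∞ := fun i a => ENNReal.ofReal (1 / (1 + s * ρB * ‖x i‖ ^ (-α))) *
      ENNReal.ofReal (1 / (1 + s * ρU * ‖x i + R • !₂[Real.cos a, Real.sin a]‖ ^ (-α)))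
    have hg0 : ∀ i, Measurable fun a => ENNReal.ofReal
        (1 / (1 + s * ρU * ‖x i + R • (!₂[Real.cos a, Real.sin a] : Plane)‖ ^ (-α))) := by
      intro i
      have : Measurable fun a : ℝ => (!₂[Real.cos a, Real.sin a] : Plane) := by
        refine (WithLp.measurable_toLp 2 _).comp (measurable_pi_lambda _ fun i => ?_)
        fin_cases i
        · exact Real.measurable_cos
        · exact Real.measurable_sin
      fun_prop
    have hg : ∀ i, Measurable (g i) := fun i => (hg0 i).const_mul _
    have h4 := lintegral_prod_eq_prod_lintegral_of_indepFun (Finset.range n)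
      (fun i (a : ℕ → ℝ) => g i (a i)) (iIndepFun_infinitePi
        (P := fun _ : ℕ => cond (volume : Measure ℝ) (Icc 0 (2 * Real.pi))) hg)
      (fun i => (hg i).comp (measurable_pi_apply i))
    refine h4.trans (Finset.prod_congr rfl fun i _ => ?_)
    rw [← lintegral_map (μ := Measure.infinitePi
      fun _ : ℕ => cond (volume : Measure ℝ) (Icc 0 (2 * Real.pi))) (g := fun a => a i) (hg i)
      (measurable_pi_apply i), Measure.infinitePi_map_eval
        (fun _ : ℕ => cond (volume : Measure ℝ) (Icc 0 (2 * Real.pi))) i]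
    simp only [g]
    rw [lintegral_const_mul _ (hg0 i), lintegral_angle hsU, ← ENNReal.ofReal_mul, cellTransform]
    exact (one_div_pos.2 (one_add_rpow_pos hsB (norm_nonneg _))).le
  simp_rw [h2]
  rw [lintegral_map _ hsm]
  exact Finset.measurable_fun_prod _ fun i _ => ENNReal.measurable_ofReal.comp
    (measurable_cellTransform.comp ((measurable_pi_apply i).norm))

/-- The Laplace transform of the interference, as an extended nonnegative random variable. -/
theorem IsModel.lintegral_expNeg_tsum_cell (hN : N.IsModel P lam K Att m) (hNR : 2 ≤ NR)
    (hNT : 1 ≤ NT) (hK : 0 ≤ K) (hAtt : 0 < Att) (hα : 2 < α) (hB : 0 ≤ ρB) (hU : 0 ≤ ρU)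
    (hR : 0 < R) (hlam : 0 ≤ lam) {s : ℝ} (hs : 0 ≤ s) :
    ∫⁻ ω, expNeg (ENNReal.ofReal s *
        ∑' i, ENNReal.ofReal (N.cellInterference α ρB ρU R i ω)) ∂P =
      ENNReal.ofReal (Real.exp (-lam * Upsilon α ρB ρU R s)) := by
  have hsB := mul_nonneg hs hB
  have hsU := mul_nonneg hs hU
  simp_rw [← ENNReal.tsum_mul_left, ← ENNReal.ofReal_mul hs]
  have h1 := tendsto_lintegral_prod_expNeg (P := P)
    (u := fun i ω => ENNReal.ofReal (s * N.cellInterference α ρB ρU R i ω)) (fun i =>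
      ENNReal.measurable_ofReal.comp ((hN.measurable_cellInterference i).const_mul s))
  simp_rw [hN.lintegral_prod_cell hNR hNT hK hAtt hB hU hs] at h1
  -- Writing each factor as `e^{-h}` puts the product over points into the form of a Laplace
  -- functional. The transform lies in `(0, 1]`, so `h` is finite and no truncation occurs.
  let h : Plane → ℝ≥0∞ := fun x =>
    ENNReal.ofReal (-Real.log (cellTransform α ρB ρU R s ‖x‖))
  have hh : Measurable h := ENNReal.measurable_ofReal.comp (Real.measurable_log.comp
    (measurable_cellTransform.comp measurable_norm)).neg
  have hexp : ∀ x, expNeg (h x) = ENNReal.ofReal (cellTransform α ρB ρU R s ‖x‖) := by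
    intro x
    have h0 := cellTransform_pos (α := α) (R := R) hsB hsU (norm_nonneg x)
    rw [expNeg_ofReal (neg_nonneg.2 (Real.log_nonpos h0.le
      (cellTransform_le_one hsB hsU (norm_nonneg x)))), neg_neg, Real.exp_log h0]
  simp_rw [← hexp] at h1
  have h2 := tendsto_lintegral_prod_expNeg (P := P) (u := fun i ω => h (N.site i ω))
    (fun i => hh.comp (hN.sites.measurable_point i))
  have : SigmaFinite (ENNReal.ofReal lam • (volume : Measure Plane)) :=
    inferInstanceAs (SigmaFinite (lam.toNNReal • (volume : Measure Plane)))
  rw [tendsto_nhds_unique h1 h2, hN.sites.lintegral_expNeg_tsum hh]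
  simp_rw [hexp]
  rw [lintegral_smul_measure, lintegral_one_sub_cellTransform hα hB hU hR hs, smul_eq_mul,
    ← ENNReal.ofReal_mul hlam, expNeg_ofReal (mul_nonneg hlam (Upsilon_nonneg hB hU hs)), neg_mul]

/-- As `u → 0` through positive values, `E e^{-uI}` tends to `P(I < ∞)`, while `e^{-λΥ(u)}` tends to
`1`. -/
lemma IsModel.ae_tsum_cell_ne_top (hN : N.IsModel P lam K Att m) (hNR : 2 ≤ NR)
    (hNT : 1 ≤ NT) (hK : 0 ≤ K) (hAtt : 0 < Att) (hα : 2 < α) (hB : 0 ≤ ρB) (hU : 0 ≤ ρU)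
    (hR : 0 < R) (hlam : 0 ≤ lam) :
    ∀ᵐ ω ∂P, ∑' i, ENNReal.ofReal (N.cellInterference α ρB ρU R i ω) ≠ ∞ := by
  set I : Ω → ℝ≥0∞ := fun ω => ∑' i, ENNReal.ofReal (N.cellInterference α ρB ρU R i ω) with hI
  have hIm : Measurable I := Measurable.tsum fun i =>
    ENNReal.measurable_ofReal.comp (hN.measurable_cellInterference i)
  let u : ℕ → ℝ := fun n => 1 / ((n : ℝ) + 1)
  have hu : Filter.Tendsto u Filter.atTop (nhds 0) := tendsto_one_div_add_atTop_nhds_zero_nat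
  have hu0 : ∀ n, 0 < u n := fun n => by positivity
  have hu1 : ∀ n, u n ≤ 1 := fun n => by
    simp only [u]
    rw [div_le_one (by positivity)]
    linarith [(n.cast_nonneg : (0 : ℝ) ≤ n)]
  have hF : MeasurableSet {ω | I ω ≠ ∞} := hIm (measurableSet_singleton ∞).compl
  have h1 : Filter.Tendsto (fun n => ∫⁻ ω, expNeg (ENNReal.ofReal (u n) * I ω) ∂P) Filter.atTop
      (nhds (∫⁻ ω, {ω | I ω ≠ ∞}.indicator (fun _ => 1) ω ∂P)) := by
    refine tendsto_lintegral_of_dominated_convergence (fun _ => 1) (fun n => ?_)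
      (fun n => .of_forall fun ω => expNeg_le_one _) (by simp) (.of_forall fun ω => ?_)
    · exact measurable_expNeg.comp (hIm.const_mul _)
    · by_cases hω : I ω = ∞
      · rw [indicator_of_notMem (by simpa using hω), hω]
        refine tendsto_const_nhds.congr fun n => ?_
        rw [ENNReal.mul_top (ENNReal.ofReal_pos.2 (hu0 n)).ne', expNeg_top]
      · rw [indicator_of_mem (by exact hω)]
        have h2 : Filter.Tendsto (fun n => ENNReal.ofReal (u n) * I ω) Filter.atTop
            (nhds (ENNReal.ofReal 0 * I ω)) :=
          ENNReal.Tendsto.mul_const (ENNReal.tendsto_ofReal hu) (.inr hω)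
        rw [ENNReal.ofReal_zero, zero_mul] at h2
        simpa [expNeg_zero, Function.comp_def] using (continuous_expNeg.tendsto 0).comp h2
  have h2 : Filter.Tendsto (fun n => ∫⁻ ω, expNeg (ENNReal.ofReal (u n) * I ω) ∂P) Filter.atTop
      (nhds 1) := by
    simp_rw [hI, fun n => hN.lintegral_expNeg_tsum_cell hNR hNT hK hAtt hα hB hU hR hlam
      (hu0 n).le]
    have h3 := (tendsto_Upsilon_zero (α := α) hα hB hU hR (fun n => (hu0 n).le) hu1 hu).const_mul
      (-lam)
    have h4 := ENNReal.tendsto_ofReal ((Real.continuous_exp.tendsto _).comp h3)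
    simpa using h4
  have h3 := tendsto_nhds_unique h1 h2
  rw [lintegral_indicator_const hF, one_mul] at h3
  exact (mem_ae_iff_prob_eq_one hF).2 h3

end Network

/-! ### The success probability -/

/-- By independence, conditioning on `I` replaces the event by the tail of `S` evaluated at `I`. -/
lemma measure_lt_of_erlangTail {Ω : Type*} [MeasurableSpace Ω] {P : Measure Ω}
    [IsProbabilityMeasure P] {S I : Ω → ℝ} (hS : Measurable S) (hI : Measurable I)
    (hSI : IndepFun S I P) (hI0 : ∀ ω, 0 ≤ I ω) {k : ℕ}
    (htail : ∀ t, 0 ≤ t → P {ω | t < S ω} = ENNReal.ofReal (erlangTail k t)) :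
    P.real {ω | I ω < S ω} = ∫ ω, erlangTail k (I ω) ∂P := by
  have hT : MeasurableSet {p : ℝ × ℝ | p.1 < p.2} := measurableSet_lt measurable_fst measurable_snd
  have e1 : {ω | I ω < S ω} = (fun ω => (I ω, S ω)) ⁻¹' {p : ℝ × ℝ | p.1 < p.2} := rfl
  have h1 : P {ω | I ω < S ω} = ∫⁻ ω, ENNReal.ofReal (erlangTail k (I ω)) ∂P := by
    rw [e1, ← Measure.map_apply (hI.prodMk hS) hT,
      (indepFun_iff_map_prod_eq_prod_map_map hI.aemeasurable hS.aemeasurable).1 hSI.symm,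
      Measure.prod_apply hT, lintegral_map (measurable_measure_prodMk_left hT) hI]
    refine lintegral_congr fun ω => ?_
    rw [Measure.map_apply hS (measurable_prodMk_left hT), ← htail _ (hI0 ω)]
    rfl
  have hm : Measurable (erlangTail k) := by
    unfold erlangTail
    fun_prop
  rw [integral_eq_lintegral_of_nonneg_ae (.of_forall fun ω => erlangTail_nonneg k (hI0 ω))
    (hm.comp hI).aestronglyMeasurable, ← h1]
  rfl

/-- The expectation of an Erlang tail in terms of the derivatives of the moment generating
function. -/
lemma integral_erlangTail_eq_sum {Ω : Type*} [MeasurableSpace Ω] {P : Measure Ω}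
    [IsProbabilityMeasure P] {I : Ω → ℝ} {s : ℝ} (hs : -s ∈ interior (integrableExpSet I P))
    (k : ℕ) : ∫ ω, erlangTail k (s * I ω) ∂P =
      ∑ n ∈ Finset.range k, s ^ n / n.factorial * iteratedDeriv n (mgf I P) (-s) := by
  have h : ∀ ω, erlangTail k (s * I ω) =
      ∑ n ∈ Finset.range k, s ^ n / n.factorial * (I ω ^ n * Real.exp (-s * I ω)) := by
    intro ω
    rw [erlangTail, Finset.mul_sum]
    refine Finset.sum_congr rfl fun n _ => ?_
    rw [mul_pow, neg_mul]
    ring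
  simp_rw [h]
  rw [integral_finsetSum _ fun n _ =>
    (integrable_pow_mul_exp_of_mem_interior_integrableExpSet hs n).const_mul _]
  refine Finset.sum_congr rfl fun n _ => ?_
  rw [integral_const_mul, iteratedDeriv_mgf hs]

/-- For nonnegative `I` the variable `e^{uI}` is bounded by one on the whole open half-line `u < 0`.
-/
lemma neg_mem_interior_integrableExpSet {Ω : Type*} [MeasurableSpace Ω] {P : Measure Ω}
    [IsProbabilityMeasure P] {I : Ω → ℝ} (hI : Measurable I) (hI0 : ∀ ω, 0 ≤ I ω) {t : ℝ}
    (ht : t < 0) : t ∈ interior (integrableExpSet I P) := by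
  refine interior_maximal (fun u (hu : u < 0) => ?_) isOpen_Iio ht
  refine Integrable.of_bound (hI.const_mul u).exp.aestronglyMeasurable 1 (.of_forall fun ω => ?_)
  rw [Real.norm_of_nonneg (Real.exp_pos _).le, Real.exp_le_one_iff]
  exact mul_nonpos_of_nonpos_of_nonneg hu.le (hI0 ω)

/-- The count at a point of zero intensity is Poisson with parameter zero, hence almost surely zero.
-/
lemma IsPoissonPointProcess.ae_ne {Ω E : Type*} [MeasurableSpace Ω] [MeasurableSpace E]
    [MeasurableSingletonClass E] {x : ℕ → Ω → E} {Λ : Measure E} {P : Measure Ω}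
    (hx : IsPoissonPointProcess x Λ P) {y : E} (hy : Λ {y} = 0) (i : ℕ) :
    ∀ᵐ ω ∂P, x i ω ≠ y := by
  have h := hx.law_count {y} (measurableSet_singleton y) (by simp [hy])
  have h0 : ∀ᵐ ω ∂P, pointCount x {y} ω = 0 := by
    rw [h.ae_iff (p := fun n => n = 0) Measurable.of_discrete,
      ae_map_iff Measurable.of_discrete.aemeasurable (MeasurableSet.of_discrete), hy]
    have h1 : poissonMeasure 0 {0} = 1 := by simp [poissonMeasure_singleton]
    have h2 := (prob_compl_eq_zero_iff (μ := poissonMeasure 0) (measurableSet_singleton 0)).2 h1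
    simp only [ae_iff, ENNReal.toNNReal_zero, Nat.cast_eq_zero]
    exact h2
  filter_upwards [h0] with ω hω hi
  rw [pointCount, encard_eq_zero] at hω
  exact (Set.eq_empty_iff_forall_notMem.1 hω i) hi

namespace Network

variable {NR NT : ℕ} {Ω : Type*} {α ρB ρU R lam K Att : ℝ}

lemma totalInterference_eq (N : Network NR NT Ω) (ω : Ω) :
    N.totalInterference α ρB ρU R ω = N.zfInterference α ρB ρU R ω := by
  rw [totalInterference, bsPower_none, mul_zero, add_zero]

lemma zfInterference_nonneg (N : Network NR NT Ω) (hB : 0 ≤ ρB) (hU : 0 ≤ ρU) (ω : Ω) :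
    0 ≤ N.zfInterference α ρB ρU R ω :=
  tsum_nonneg fun i => N.cellInterference_nonneg hB hU i ω

lemma zfInterference_eq_toReal (N : Network NR NT Ω) (hB : 0 ≤ ρB) (hU : 0 ≤ ρU) (ω : Ω) :
    N.zfInterference α ρB ρU R ω =
      (∑' i, ENNReal.ofReal (N.cellInterference α ρB ρU R i ω)).toReal := by
  rw [ENNReal.tsum_toReal_eq fun i => ENNReal.ofReal_ne_top]
  exact tsum_congr fun i => (ENNReal.toReal_ofReal (N.cellInterference_nonneg hB hU i ω)).symm

variable [MeasurableSpace Ω] {P : Measure Ω} {N : Network NR NT Ω} {m : Fin NR → Fin NT → ℂ}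

lemma IsModel.measurable_zfInterference (hN : N.IsModel P lam K Att m) (hB : 0 ≤ ρB)
    (hU : 0 ≤ ρU) : Measurable (N.zfInterference α ρB ρU R) := by
  rw [funext fun ω => N.zfInterference_eq_toReal (α := α) (R := R) hB hU ω]
  exact ENNReal.measurable_toReal.comp (Measurable.tsum fun i =>
    ENNReal.measurable_ofReal.comp (hN.measurable_cellInterference i))

variable [IsProbabilityMeasure P]

lemma IsModel.ae_summable_cell (hN : N.IsModel P lam K Att m) (hNR : 2 ≤ NR)
    (hNT : 1 ≤ NT) (hK : 0 ≤ K) (hAtt : 0 < Att) (hα : 2 < α) (hB : 0 ≤ ρB) (hU : 0 ≤ ρU)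
    (hR : 0 < R) (hlam : 0 ≤ lam) :
    ∀ᵐ ω ∂P, Summable fun i => N.cellInterference α ρB ρU R i ω := by
  filter_upwards [hN.ae_tsum_cell_ne_top hNR hNT hK hAtt hα hB hU hR hlam] with ω hω
  have h := ENNReal.summable_toReal hω
  simpa only [ENNReal.toReal_ofReal (N.cellInterference_nonneg hB hU _ ω)] using h

lemma IsModel.mgf_zfInterference (hN : N.IsModel P lam K Att m) (hNR : 2 ≤ NR)
    (hNT : 1 ≤ NT) (hK : 0 ≤ K) (hAtt : 0 < Att) (hα : 2 < α) (hB : 0 ≤ ρB) (hU : 0 ≤ ρU)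
    (hR : 0 < R) (hlam : 0 ≤ lam) {s : ℝ} (hs : 0 ≤ s) :
    mgf (N.zfInterference α ρB ρU R) P (-s) = Real.exp (-lam * Upsilon α ρB ρU R s) := by
  have hI := hN.measurable_zfInterference (α := α) (R := R) hB hU
  rw [mgf, integral_eq_lintegral_of_nonneg_ae (.of_forall fun ω => (Real.exp_pos _).le)
    (hI.const_mul (-s)).exp.aestronglyMeasurable,
    ← ENNReal.toReal_ofReal (Real.exp_pos (-lam * Upsilon α ρB ρU R s)).le,
    ← hN.lintegral_expNeg_tsum_cell hNR hNT hK hAtt hα hB hU hR hlam hs]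
  congr 1
  refine lintegral_congr_ae ?_
  filter_upwards [hN.ae_tsum_cell_ne_top hNR hNT hK hAtt hα hB hU hR hlam] with ω hω
  rw [← ENNReal.ofReal_toReal hω, ← N.zfInterference_eq_toReal hB hU, ← ENNReal.ofReal_mul hs,
    expNeg_ofReal (mul_nonneg hs (N.zfInterference_nonneg hB hU ω)), neg_mul]

lemma IsModel.indepFun_ulPower_zfInterference (hN : N.IsModel P lam K Att m) (hNR : 2 ≤ NR)
    (hNT : 1 ≤ NT) (hK : 0 ≤ K) (hAtt : 0 < Att) (hB : 0 ≤ ρB) (hU : 0 ≤ ρU) :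
    IndepFun (N.ulPower none) (N.zfInterference α ρB ρU R) P := by
  rw [funext fun ω => N.zfInterference_eq_toReal (α := α) (R := R) hB hU ω]
  refine (hN.indepFun_and_hasLaw_gain hNR hNT hK hAtt).1.comp (φ := id)
    (ψ := fun p : (ℕ → Plane) × (ℕ → ℝ) × (ℕ ⊕ ℕ → ℂ) => (∑' i, ENNReal.ofReal
      (cellTerm α ρB ρU R (p.1 i) (p.2.1 i) (p.2.2 (.inl i)) (p.2.2 (.inr i)))).toReal)
    measurable_id ?_
  refine ENNReal.measurable_toReal.comp (Measurable.tsum fun i => ENNReal.measurable_ofReal.comp ?_)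
  exact (measurable_cellTerm α ρB ρU R).comp (f := fun p : (ℕ → Plane) × (ℕ → ℝ) ×
    (ℕ ⊕ ℕ → ℂ) => (p.1 i, p.2.1 i, p.2.2 (.inl i), p.2.2 (.inr i))) (by fun_prop)

lemma IsModel.ae_gain_ne_zero (hN : N.IsModel P lam K Att m) (hNR : 2 ≤ NR)
    (hNT : 1 ≤ NT) (hK : 0 ≤ K) (hAtt : 0 < Att) (k : ℕ ⊕ ℕ) : ∀ᵐ ω ∂P, N.gain ω k ≠ 0 := by
  have hpa : IsProbabilityMeasure (cond (volume : Measure ℝ) (Icc 0 (2 * Real.pi))) :=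
    cond_isProbabilityMeasure_of_finite (by simp [Real.pi_pos])
      (by simp [ENNReal.mul_eq_top])
  have h0 : ∀ᵐ w ∂(complexNormal 0 1), w ≠ 0 := by
    rw [ae_iff]
    simp only [not_not]
    exact complexNormal_singleton _ one_ne_zero 0
  have h1 := (measurePreserving_eval_infinitePi (fun _ : ℕ ⊕ ℕ => complexNormal 0 1)
    k).quasiMeasurePreserving.ae h0
  have h2 := (Measure.quasiMeasurePreserving_snd
    (μ := Measure.infinitePi fun _ : ℕ => cond (volume : Measure ℝ) (Icc 0 (2 * Real.pi)))).ae h1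
  have h3 := (Measure.quasiMeasurePreserving_snd (μ := P.map fun ω i => N.site i ω)).ae h2
  exact ((hN.indepFun_and_hasLaw_gain hNR hNT hK hAtt).2.ae_iff
    (p := fun q => q.2.2 k ≠ 0) ((measurable_pi_apply k).comp measurable_snd.snd
      (measurableSet_singleton 0).compl).mem).2 h3

/-- One station suffices: station `0` is almost surely off the origin and has nonzero gain.
Positivity matters because a quotient by zero is zero by convention, which would spoil the
rearrangement of the SIR event. -/
lemma IsModel.ae_zfInterference_pos (hN : N.IsModel P lam K Att m) (hNR : 2 ≤ NR)
    (hNT : 1 ≤ NT) (hK : 0 ≤ K) (hAtt : 0 < Att) (hα : 2 < α) (hB : 0 < ρB) (hU : 0 ≤ ρU)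
    (hR : 0 < R) (hlam : 0 ≤ lam) : ∀ᵐ ω ∂P, 0 < N.zfInterference α ρB ρU R ω := by
  filter_upwards [hN.ae_summable_cell hNR hNT hK hAtt hα hB.le hU hR hlam,
    hN.ae_gain_ne_zero hNR hNT hK hAtt (.inl 0), hN.sites.ae_ne (y := 0) (by simp) 0]
    with ω h1 h2 h3
  refine h1.tsum_pos (fun i => N.cellInterference_nonneg hB.le hU i ω) 0 ?_
  rw [cellInterference_eq, cellTerm]
  have h4 := Real.rpow_pos_of_pos (norm_pos_iff.2 h3) (-α)
  have h5 := norm_pos_iff.2 h2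
  positivity

/-- The success probability of the first hop. -/
theorem IsModel.measure_firstHopSIR_gt (hN : N.IsModel P lam K Att m) (hNR : 2 ≤ NR)
    (hNT : 1 ≤ NT) (hK : 0 ≤ K) (hAtt : 0 < Att) (hα : 2 < α) (hB : 0 < ρB) (hU : 0 < ρU)
    (hR : 0 < R) (hlam : 0 ≤ lam) {θ : ℝ} (hθ : 0 < θ) :
    P.real {ω | θ < N.firstHopSIR α ρB ρU R ω} =
      ∫ ω, erlangTail (NR - 1) (θ * ρU⁻¹ * R ^ α * N.zfInterference α ρB ρU R ω) ∂P := by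
  have hs : 0 < θ * ρU⁻¹ * R ^ α := by positivity
  have hI := hN.measurable_zfInterference (α := α) (R := R) hB.le hU.le
  have hS : Measurable (N.ulPower none) := by
    simp_rw [funext fun ω => N.ulPower_none ω]
    exact (measurable_starProjection_orthogonal_singleton
        (hN.measurable_effChannel none) (hN.measurable_ulChannel none)).norm.pow_const 2
  rw [← measure_lt_of_erlangTail hS (hI.const_mul _)
    ((hN.indepFun_ulPower_zfInterference hNR hNT hK hAtt hB.le hU.le).comp measurable_id
      (measurable_const_mul _)) (fun ω => mul_nonneg hs.le (N.zfInterference_nonneg hB.le hU.le ω))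
    (fun t ht => hN.measure_ulPower_none_gt (by omega) hNT hK hAtt ht)]
  refine measureReal_congr ?_
  filter_upwards [hN.ae_zfInterference_pos hNR hNT hK hAtt hα hB hU.le hR hlam] with ω hω
  refine propext ?_
  change θ < ρU * R ^ (-α) * N.ulPower none ω / N.zfInterference α ρB ρU R ω ↔
    θ * ρU⁻¹ * R ^ α * N.zfInterference α ρB ρU R ω < N.ulPower none ω
  have hRα := Real.rpow_pos_of_pos hR α
  rw [lt_div_iff₀ hω, Real.rpow_neg hR.le]
  have e : θ * ρU⁻¹ * R ^ α * N.zfInterference α ρB ρU R ω =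
      θ * N.zfInterference α ρB ρU R ω / (ρU * (R ^ α)⁻¹) := by
    field_simp
  rw [e, div_lt_iff₀' (by positivity)]

end Network

end FDNet

end

/-! ### Smoothness and the derivative formula for the success probability -/

theorem theorem4 {Ω : Type*} [MeasurableSpace Ω] (P : Measure Ω) [IsProbabilityMeasure P]
    (NR NT : ℕ) (hNR : 2 ≤ NR) (hNT : 1 ≤ NT)
    (α ρB ρU R lam K Att θ : ℝ) (hα : 2 < α) (hρB : 0 < ρB) (hρU : 0 < ρU) (hR : 0 < R)
    (hlam : 0 < lam) (hK : 0 ≤ K) (hAtt : 0 < Att) (hθ : 0 < θ)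
    (m : Fin NR → Fin NT → ℂ) (N : FDNet.Network NR NT Ω)
    (hN : N.IsModel P lam K Att m) :
    (∀ᵐ ω ∂P, Summable fun i => N.cellInterference α ρB ρU R i ω) ∧
    (∀ ω, N.totalInterference α ρB ρU R ω = N.zfInterference α ρB ρU R ω) ∧
    (∀ s : ℝ, 0 < s → IntegrableOn (FDNet.upsilonIntegrand α ρB ρU R s) (Ioi 0)) ∧
    ContDiffOn ℝ ((⊤ : ℕ∞) : WithTop ℕ∞) (fun s => Real.exp (-lam * FDNet.Upsilon α ρB ρU R s)) (Ioi 0) ∧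
    P.real {ω | θ < N.firstHopSIR α ρB ρU R ω} =
      ∑ n ∈ Finset.range (NR - 1),
        (-(θ * ρU⁻¹ * R ^ α)) ^ n / (n.factorial : ℝ) *
          iteratedDeriv n (fun s => Real.exp (-lam * FDNet.Upsilon α ρB ρU R s))
            (θ * ρU⁻¹ * R ^ α) := by
  have hI := hN.measurable_zfInterference (α := α) (R := R) hρB.le hρU.le
  have hint : ∀ s : ℝ, 0 < s →
      -s ∈ interior (integrableExpSet (N.zfInterference α ρB ρU R) P) := fun s hs =>
    FDNet.neg_mem_interior_integrableExpSet hI (N.zfInterference_nonneg hρB.le hρU.le)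
      (neg_lt_zero.2 hs)
  have hmgf : ∀ s ∈ Ioi (0 : ℝ), Real.exp (-lam * FDNet.Upsilon α ρB ρU R s) =
      mgf (N.zfInterference α ρB ρU R) P (-s) := fun s hs =>
    (hN.mgf_zfInterference hNR hNT hK hAtt hα hρB.le hρU.le hR hlam.le (mem_Ioi.1 hs).le).symm
  refine ⟨hN.ae_summable_cell hNR hNT hK hAtt hα hρB.le hρU.le hR hlam.le,
    N.totalInterference_eq,
    fun s hs => FDNet.integrableOn_upsilonIntegrand hα hρB.le hρU.le hR hs.le, ?_, ?_⟩
  · refine ContDiffOn.congr ?_ hmgf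
    exact (analyticOnNhd_mgf.contDiffOn isOpen_interior.uniqueDiffOn).comp contDiff_neg.contDiffOn
      (fun s hs => hint s hs)
  · have hs : 0 < θ * ρU⁻¹ * R ^ α := by positivity
    rw [hN.measure_firstHopSIR_gt hNR hNT hK hAtt hα hρB hρU hR hlam.le hθ,
      FDNet.integral_erlangTail_eq_sum (hint _ hs)]
    refine Finset.sum_congr rfl fun n _ => ?_
    -- The identity with the moment generating function is available only for `s > 0`; agreement
    -- near the evaluation point is enough for derivatives.
    have h1 : (fun s => Real.exp (-lam * FDNet.Upsilon α ρB ρU R s)) =ᶠ[nhds (θ * ρU⁻¹ * R ^ α)]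
        fun s => mgf (N.zfInterference α ρB ρU R) P (-s) :=
      Filter.eventually_of_mem (isOpen_Ioi.mem_nhds hs) hmgf
    rw [h1.iteratedDeriv_eq, iteratedDeriv_comp_neg, smul_eq_mul, neg_pow (θ * ρU⁻¹ * R ^ α)]
    -- One sign comes from `(-s)^n`, the other from differentiating `n` times through `s ↦ -s`.
    have h2 : ((-1 : ℝ) ^ n) * (-1) ^ n = 1 := by rw [← mul_pow]; simp
    linear_combination (-(θ * ρU⁻¹ * R ^ α) ^ n / n.factorial *
      iteratedDeriv n (mgf (N.zfInterference α ρB ρU R) P) (-(θ * ρU⁻¹ * R ^ α))) * h2
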